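/- **Setting.** Let $\mathcal V$ be a vocabulary (predicate and function symbols; constants are $0$-ary function symbols). For a tuple $\vec a$ of elements ("nodes") of a $\mathcal V$-structure, let $N(\vec a)$ be the substructure generated by $\vec a$. For tuples $\vec a\in\mathbb T^d$, $\vec b\in\mathbb T'^d$ write $\vec a\simeq\vec b$ if there is a *local isomorphism* $\beta:N(\vec a)\to N(\vec b)$, i.e. an isomorphism with $\beta(\vec a)=\vec b$. *Programs.* Fix a finite set $\Sigma$ of commands, a finite set $\mathbf L$ of locations with designated $l_{\mathrm{init}},l_{\mathrm{err}}\in\mathbf L$, maps $\mathsf{src},\mathsf{tgt}:\Sigma\to\mathbf L$, and a data domain $\mathbb D$. A program over $\mathbb T$ is a pair of a map $P:\mathbb T\to 2^\Sigma$ and a family of relations $[\![\sigma:v]\!]\subseteq(N(v)\to\mathbb D)^2$ ($\sigma\in\Sigma$, $v\in\mathbb T$). The indexed command $\langle\sigma:v\rangle$ leads from $(\lambda,\mu)$ to $(\lambda',\mu')$, where $\lambda,\lambda':\mathbb T\to\mathbf L$ and $\mu,\mu':\mathbb T\to\mathbb D$, if $\sigma\in P(v)$, $\lambda(v)=\mathsf{src}(\sigma)$,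 $\lambda'=\lambda\oplus\{v\mapsto\mathsf{tgt}(\sigma)\}$, $(\mu|_{N(v)},\mu'|_{N(v)})\in[\![\sigma:v]\!]$, and $\mu=\mu'$ outside $N(v)$. A *parameterized program* is a family $\mathcal P=\{(P_i,[\![-]\!]_i)\}_{i\in\mathcal I}$ of programs over $\mathcal V$-structures $\mathbb T_i$ (with the same $\Sigma,\mathbf L,\mathsf{src},\mathsf{tgt},l_{\mathrm{init}},l_{\mathrm{err}},\mathbb D$) such that, for every local isomorphism $\beta$ from $a\in\mathbb T_i$ to $b\in\mathbb T_j$, $P_i(a)=P_j(b)$ and $[\![\sigma:a]\!]_i=\beta^*[\![\sigma:b]\!]_j$ for all $\sigma\in\Sigma$, where $\beta^*$ is the pullback $\mu\mapsto\mu\circ\beta$. *Boolean programs.* $\mathcal P$ is *Boolean* if $\mathbb D=\{0,1\}^n$ for some $n$ and there are finite sets $\mathsf{rw}_i(a)\subseteq N(a)$ and partial functions $f_{i,a,\sigma}$ on the valuations $\mathsf{rw}_i(a)\to\mathbb D$, both respecting all local isomorphisms between nodes of members of the family, such that $(\mu,\mu')\in[\![\sigma:a]\!]_i$ iff $f_{i,a,\sigma}(\mu|_{\mathsf{rw}_i(a)})=\mu'|_{\mathsf{rw}_i(a)}$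 and $\mu=\mu'$ outside $\mathsf{rw}_i(a)$. All variables are initialized to $0$: such a $\mathcal P$ is *safe* if in no member of the family a finite sequence of commands leads from $(\lambda\equiv l_{\mathrm{init}},\ \mu\equiv 0)$ to a state $(\lambda',\mu')$ with $l_{\mathrm{err}}$ in the range of $\lambda'$. *Limits.* $\mathbb T$ is a *limit* of $\{\mathbb T_i\}$ if every $\mathbb T_i$ embeds in $\mathbb T$ and every finitely generated substructure of $\mathbb T$ embeds in some $\mathbb T_i$. The *limit program* of $\mathcal P$ over $\mathbb T$ is then given by $P(v)=P_i(u)$ and $[\![\sigma:v]\!]=\beta^*[\![\sigma:u]\!]_i$ for any local isomorphism $\beta$ from $v\in\mathbb T$ to some $u\in\mathbb T_i$. **Statement.** Fix a $\mathcal V$-structure $\mathbb T$ such that the nodes and the symbols of $\mathcal V$ are finitely representable and the arities and interpretations of the symbols are computable. Suppose that 1. $\mathbb T$ is homogeneous: every isomorphism between finitely generated substructures of $\mathbb T$ extends to an automorphism of $\mathbb T$; 2. $\mathbb T^d/{\simeq}$ is finite for every $d\ge1$, and there is an algorithm that maps $d$ to a list of quantifier-free formulas defining the equivalence classes; 3.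 satisfiability in $\mathbb T$ of quantifier-free formulas with parameters from $\mathbb T$ is decidable; 4. for every finite relational vocabulary $\mathcal Q$ whose symbols have arity at most $1$, the covering preorder is a well-quasi-order on configurations. Here a configuration is a finite set of atoms $q(\vec a)$ with $q\in\mathcal Q$ and nodes $\vec a$, and $\mathcal C\preceq\mathcal C'$ iff some automorphism $\pi$ of $\mathbb T$ satisfies $q(\pi(\vec a))\in\mathcal C'$ for all $q(\vec a)\in\mathcal C$. Then safety of parameterized Boolean programs of which $\mathbb T$ is a limit is decidable. That is, there is one algorithm that decides whether $\mathcal P$ is safe, for every parameterized Boolean program $\mathcal P$ of whose topologies $\mathbb T$ is a limit, given as input: $n$, the finite data $\Sigma,\mathbf L,\mathsf{src},\mathsf{tgt},l_{\mathrm{init}},l_{\mathrm{err}}$, and (the code of) an algorithm that computes, for every node $v$ of $\mathbb T$, a finite description of the limit program at $v$: the set $P(v)$, a list of terms whose values at $v$ are the nodes that commands at $v$ access, and a table of the relations $[\![\sigma:v]\!]$ on the valuations of these nodes. -/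

import Mathlib

namespace ParamTopo

open FirstOrder.Language
open scoped FirstOrder

/-! ### Neighbourhoods and local symmetry -/

section LocalSymmetry

variable (L : FirstOrder.Language) {T T' : Type*} [L.Structure T] [L.Structure T'] {d : ℕ}

/-- The neighbourhood `N(a)` of a tuple of nodes: the substructure generated by its entries. -/
abbrev nbhd (a : Fin d → T) : L.Substructure T :=
  Substructure.closure L (Set.range a)

theorem mem_nbhd (a : Fin d → T) (i : Fin d) : a i ∈ nbhd L a :=
  Substructure.subset_closure ⟨i, rfl⟩

/-- The neighbourhood `N(v)` of a single node. -/
abbrev nodeNbhd (v : T) : L.Substructure T := nbhd L ![v]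

/-- The node `v`, as an element of its own neighbourhood. -/
def nodeSelf (v : T) : nodeNbhd L v := ⟨v, mem_nbhd L ![v] 0⟩

/-- A local isomorphism from the tuple `a` to the tuple `b`: an isomorphism `N(a) ≅ N(b)`
that maps `a` to `b` entrywise. -/
structure LocalIso (a : Fin d → T) (b : Fin d → T') where
  toEquiv : nbhd L a ≃[L] nbhd L b
  map_tuple : ∀ i, (toEquiv ⟨a i, mem_nbhd L a i⟩ : T') = b i

/-- Local symmetry `a ≃ b` of two tuples of the same length. -/
def LocSymm (a : Fin d → T) (b : Fin d → T') : Prop := Nonempty (LocalIso L a b)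

/-- A local isomorphism between two nodes. -/
abbrev NodeIso (a : T) (b : T') := LocalIso L ![a] ![b]

end LocalSymmetry

/-! ### Programs over a topology -/

/-- The locations of a program: source and target of each command, and the two distinguished
locations. -/
structure Control (Cmd Loc : Type*) where
  src : Cmd → Loc
  tgt : Cmd → Loc
  init : Loc
  err : Loc

/-- A concurrent program `⟨P, ⟦-⟧⟩` over the topology `T` with commands `Cmd` and data domain
`D`: `code v` is `P(v)`, and `sem σ v` is the relation `⟦σ : v⟧` on valuations of `N(v)`. -/
structure Program (L : FirstOrder.Language) (T : Type*) [L.Structure T] (Cmd D : Type*) where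
  code : T → Set Cmd
  sem : Cmd → (v : T) → Set ((nodeNbhd L v → D) × (nodeNbhd L v → D))

namespace Program

variable {L : FirstOrder.Language} {T : Type*} [L.Structure T] {Cmd Loc D : Type*}

/-- The step `lam → lam'` on location maps that is induced by the indexed command `⟨σ : v⟩`. -/
def LocStep (K : Control Cmd Loc) (P : Program L T Cmd D) (e : Cmd × T)
    (lam lam' : T → Loc) : Prop :=
  e.1 ∈ P.code e.2 ∧ lam e.2 = K.src e.1 ∧ lam' e.2 = K.tgt e.1 ∧
    ∀ u, u ≠ e.2 → lam' u = lam u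

/-- The word `ρ` leads from the location map `lam` to the location map `lam'`. -/
def LocRun (K : Control Cmd Loc) (P : Program L T Cmd D) :
    List (Cmd × T) → (T → Loc) → (T → Loc) → Prop
  | [], lam, lam' => lam = lam'
  | e :: ρ, lam, lam' => ∃ lam₁, P.LocStep K e lam lam₁ ∧ P.LocRun K ρ lam₁ lam'

/-- The error runs: syntactic runs that end in a location map whose range contains the error
location. -/
def errRuns (K : Control Cmd Loc) (P : Program L T Cmd D) : Set (List (Cmd × T)) :=
  {ρ | ∃ lam, P.LocRun K ρ (fun _ => K.init) lam ∧ K.err ∈ Set.range lam}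

/-- The semantics of `⟨σ : v⟩` on valuations of the whole topology: nothing outside `N(v)` is
read or written. -/
def globalSem (P : Program L T Cmd D) (e : Cmd × T) : Set ((T → D) × (T → D)) :=
  {p | ((fun w : nodeNbhd L e.2 => p.1 w, fun w : nodeNbhd L e.2 => p.2 w) ∈ P.sem e.1 e.2) ∧
    ∀ w, w ∉ nodeNbhd L e.2 → p.1 w = p.2 w}

/-- The semantics of a word, by composition of relations. -/
def globalRun (P : Program L T Cmd D) : List (Cmd × T) → Set ((T → D) × (T → D))
  | [] => {p | p.1 = p.2}
  | e :: ρ => {p | ∃ μ, (p.1, μ) ∈ P.globalSem e ∧ (μ, p.2) ∈ P.globalRun ρ}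

/-- Safety with respect to a set `I` of initial valuations: every error run is infeasible
from `I`. -/
def SafeFrom (K : Control Cmd Loc) (P : Program L T Cmd D) (I : Set (T → D)) : Prop :=
  ∀ ρ ∈ P.errRuns K, ∀ μ ∈ I, ∀ μ', (μ, μ') ∉ P.globalRun ρ

end Program

/-- The pullback `β^*` of a relation on valuations of `N(b)` along a local isomorphism
`β : N(a) → N(b)`. -/
def pull {L : FirstOrder.Language} {T T' : Type*} [L.Structure T] [L.Structure T'] {D : Type*}
    {a : T} {b : T'} (β : NodeIso L a b)
    (R : Set ((nodeNbhd L b → D) × (nodeNbhd L b → D))) :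
    Set ((nodeNbhd L a → D) × (nodeNbhd L a → D)) :=
  (fun p => (p.1 ∘ β.toEquiv, p.2 ∘ β.toEquiv)) '' R

/-! ### Parameterized programs -/

universe u v w x y z

set_option linter.checkUnivs false in
/-- A parameterized program: a family of programs over topologies of a common vocabulary, such
that locally symmetric nodes run the same code with the same semantics. -/
structure ParamProgram (L : FirstOrder.Language.{u, v}) (Cmd : Type w) (D : Type x) where
  Index : Type y
  Node : Index → Type z
  [str : ∀ i, L.Structure (Node i)]
  prog : ∀ i, Program L (Node i) Cmd D
  code_symm : ∀ (i j : Index) (a : Node i) (b : Node j), LocSymm L ![a] ![b] →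
    (prog i).code a = (prog j).code b
  sem_symm : ∀ (i j : Index) (a : Node i) (b : Node j) (β : NodeIso L a b) (σ : Cmd),
    (prog i).sem σ a = pull β ((prog j).sem σ b)

attribute [instance] ParamProgram.str

/-- `T` is a limit of the family of topologies of `𝓟`. -/
def IsLimit {L : FirstOrder.Language} (T : Type*) [L.Structure T] {Cmd D : Type*}
    (𝓟 : ParamProgram L Cmd D) : Prop :=
  (∀ i, Nonempty (𝓟.Node i ↪[L] T)) ∧
    ∀ S : L.Substructure T, S.FG → ∃ i, Nonempty (S ↪[L] 𝓟.Node i)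

/-- The program over `T` that is induced by `𝓟`: a node `v` that is locally symmetric to a node
`u` of a member of the family has the code of `u`, and the semantics of `u` pulled back to `v`.
If `T` is a limit of the topologies of `𝓟`, this is the limit program. -/
def limitProgram {L : FirstOrder.Language} (T : Type*) [L.Structure T] {Cmd D : Type*}
    (𝓟 : ParamProgram L Cmd D) : Program L T Cmd D where
  code v := {σ | ∃ (i : 𝓟.Index) (u : 𝓟.Node i), LocSymm L ![v] ![u] ∧ σ ∈ (𝓟.prog i).code u}
  sem σ v := {p | ∃ (i : 𝓟.Index) (u : 𝓟.Node i) (β : NodeIso L v u),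
    p ∈ pull β ((𝓟.prog i).sem σ u)}

/-! ### Parameterized Boolean programs -/

/-- Bit-vectors of length `n`. -/
abbrev Bits (n : ℕ) : Type := Fin n → Bool

/-- A parameterized Boolean program: every indexed command `⟨σ : a⟩` is given by a partial
function on the valuations of a finite set `rw i a ⊆ N(a)` and accesses nothing else; `rw` and
the partial functions respect local isomorphisms. -/
def ParamProgram.IsBoolean {L : FirstOrder.Language} {Cmd : Type*} {n : ℕ}
    (𝓟 : ParamProgram L Cmd (Bits n)) : Prop :=
  ∃ (rw : ∀ (i : 𝓟.Index) (a : 𝓟.Node i), Set (nodeNbhd L a))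
    (f : ∀ (i : 𝓟.Index) (a : 𝓟.Node i), Cmd → (rw i a → Bits n) → Option (rw i a → Bits n)),
    (∀ i a, (rw i a).Finite) ∧
    (∀ (i j : 𝓟.Index) (a : 𝓟.Node i) (b : 𝓟.Node j) (β : NodeIso L a b),
      ∃ h : ∀ x, x ∈ rw i a ↔ β.toEquiv x ∈ rw j b,
        ∀ (σ : Cmd) (μ : rw j b → Bits n),
          f i a σ (fun x : rw i a => μ ⟨β.toEquiv x.1, (h x.1).1 x.2⟩) =
            (f j b σ μ).map fun μ' (x : rw i a) => μ' ⟨β.toEquiv x.1, (h x.1).1 x.2⟩) ∧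
    ∀ (i : 𝓟.Index) (a : 𝓟.Node i) (σ : Cmd),
      (𝓟.prog i).sem σ a =
        {p | f i a σ (fun x : rw i a => p.1 x.1) = some (fun x : rw i a => p.2 x.1) ∧
          ∀ w, w ∉ rw i a → p.1 w = p.2 w}

/-- Safety of a parameterized Boolean program: every member is safe when all variables are
initialized to `0`. -/
def ParamProgram.Safe {L : FirstOrder.Language} {Cmd Loc : Type*} {n : ℕ}
    (𝓟 : ParamProgram L Cmd (Bits n)) (K : Control Cmd Loc) : Prop :=
  ∀ i, (𝓟.prog i).SafeFrom K {fun _ _ => false}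

/-! ### Effective topologies

Nodes and symbols are finitely representable: they form `Primcodable` types. -/

/-- Function symbols together with their arities. -/
abbrev FunSym (L : FirstOrder.Language) := Σ n, L.Functions n

/-- Relation symbols together with their arities. -/
abbrev RelSym (L : FirstOrder.Language) := Σ n, L.Relations n

/-- The arities and the interpretations of the symbols are computable. -/
structure Effective (L : FirstOrder.Language) (T : Type*) [L.Structure T] [Primcodable T]
    [Primcodable (FunSym L)] [Primcodable (RelSym L)] : Prop where
  funArity : Computable (fun s : FunSym L => s.1)
  relArity : Computable (fun s : RelSym L => s.1)
  funInterp : ∃ F : FunSym L × List T → Option T, Computable F ∧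
    ∀ (n : ℕ) (g : L.Functions n) (v : Fin n → T),
      F (⟨n, g⟩, List.ofFn v) = some (Structure.funMap g v)
  relInterp : ∃ R : RelSym L × List T → Bool, Computable R ∧
    ∀ (n : ℕ) (r : L.Relations n) (v : Fin n → T),
      R (⟨n, r⟩, List.ofFn v) = true ↔ Structure.RelMap r v

/-- The alphabet in which formulas with free variables from `α` are written: free and bound
variables, function symbols, relation symbols, and the logical symbols
`⊥` (`0`), `=` (`1`), `→` (`2`), `∀` (`3`). -/
abbrev Tok (L : FirstOrder.Language) (α : Type*) := ((α ⊕ ℕ) ⊕ FunSym L) ⊕ (RelSym L ⊕ Fin 4)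

/-- The prefix notation of a term inside a formula, its free variables renamed by `r`. -/
def termWord {L : FirstOrder.Language} {α β : Type*} (r : α → β) {n : ℕ}
    (t : L.Term (α ⊕ Fin n)) :
    List (Tok L β) :=
  t.listEncode.map fun s => Sum.inl (s.map (Sum.map r Fin.val) id)

/-- The prefix notation of a formula, its free variables renamed by `r`. -/
def formulaWord {L : FirstOrder.Language} {α β : Type*} (r : α → β) :
    {n : ℕ} → L.BoundedFormula α n → List (Tok L β)
  | _, .falsum => [Sum.inr (Sum.inr 0)]
  | _, .equal t u => Sum.inr (Sum.inr 1) :: (termWord r t ++ termWord r u)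
  | _, .rel (l := k) R ts =>
      Sum.inr (Sum.inl ⟨k, R⟩) :: (List.finRange k).flatMap fun i => termWord r (ts i)
  | _, .imp φ ψ => Sum.inr (Sum.inr 2) :: (formulaWord r φ ++ formulaWord r ψ)
  | _, .all φ => Sum.inr (Sum.inr 3) :: formulaWord r φ

/-- There is an algorithm that maps every `d ≥ 1` to a (finite) list of quantifier-free formulas
in `d` free variables that define the classes of local symmetry on `T^d`. In particular there
are finitely many classes. -/
def ComputableClasses (L : FirstOrder.Language) (T : Type*) [L.Structure T]
    [Primcodable (FunSym L)] [Primcodable (RelSym L)] : Prop :=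
  ∃ E : ℕ → List (List (Tok L ℕ)), Computable E ∧
    ∀ d : ℕ, 0 < d → ∃ Φ : List (L.Formula (Fin d)),
      E d = Φ.map (fun φ => formulaWord Fin.val φ) ∧
      (∀ φ ∈ Φ, φ.IsQF ∧ ∃ a : Fin d → T, ∀ b : Fin d → T, φ.Realize b ↔ LocSymm L a b) ∧
      ∀ a : Fin d → T, ∃ φ ∈ Φ, φ.Realize a

/-- Satisfiability in `T` of quantifier-free formulas with parameters from `T` is decidable.
A formula over the vocabulary with a constant for every node is written as a formula whose free
variables are nodes (standing for themselves) and numbers (the proper free variables). -/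
def DecidableSat (L : FirstOrder.Language) (T : Type*) [L.Structure T] [Primcodable T]
    [Primcodable (FunSym L)] [Primcodable (RelSym L)] : Prop :=
  ∃ S : List (Tok L (T ⊕ ℕ)) → Bool, Computable S ∧
    ∀ φ : L.Formula (T ⊕ ℕ), φ.IsQF →
      (S (formulaWord id φ) = true ↔ ∃ v : ℕ → T, φ.Realize (Sum.elim id v))

/-! ### Configurations and the covering preorder -/

/-- A configuration over a relational vocabulary with symbols `Q` of arities `ar`: a finite set
of atoms `q(a₁, …, aₖ)` with `q` in `Q` and nodes `aᵢ`. -/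
abbrev Config (T : Type*) {Q : Type*} (ar : Q → ℕ) := Finset (Σ q : Q, Fin (ar q) → T)

/-- The covering preorder: some automorphism of `T` maps every atom of `C` to one of `C'`. -/
def Covers (L : FirstOrder.Language) {T : Type*} [L.Structure T] {Q : Type*} {ar : Q → ℕ}
    (C C' : Config T ar) : Prop :=
  ∃ π : T ≃[L] T, ∀ x ∈ C, (⟨x.1, fun k => π (x.2 k)⟩ : Σ q : Q, Fin (ar q) → T) ∈ C'

/-- The covering preorder is a well-quasi-order on the configurations over every finite
relational vocabulary with symbols of arity at most `1`. -/
def MonadicWQO (L : FirstOrder.Language) (T : Type*) [L.Structure T] : Prop :=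
  ∀ (Q : Type) [Finite Q] (ar : Q → ℕ), (∀ q, ar q ≤ 1) →
    WellQuasiOrdered (Covers L (T := T) (ar := ar))

/-! ### Finite presentations of parameterized Boolean programs -/

/-- Finite data for one node `v`: the commands in `P(v)`, a list of terms in one variable that
represents the accessed nodes, and a table of the steps `(σ, old values, new values)`; values are
lists of bit-vectors, one for each term. -/
abbrev NodeData (L : FirstOrder.Language) :=
  List ℕ × List (List (Unit ⊕ FunSym L)) × List (ℕ × List (List Bool) × List (List Bool))

/-- The value of a term at the node `v`, which lies in the neighbourhood of `v`. -/
def termAt {L : FirstOrder.Language} {T : Type*} [L.Structure T] (v : T) (t : L.Term Unit) :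
    nodeNbhd L v :=
  t.realize fun _ => nodeSelf L v

/-- The values of a valuation of `N(v)` on a list of terms. -/
def readTerms {L : FirstOrder.Language} {T : Type*} [L.Structure T] {n : ℕ} (v : T)
    (ts : List (L.Term Unit)) (μ : nodeNbhd L v → Bits n) : List (List Bool) :=
  ts.map fun t => List.ofFn (μ (termAt v t))

/-- The finite data `x` describes the code and the semantics of the program `P` at `v`. -/
def Describes {L : FirstOrder.Language} {T : Type*} [L.Structure T] {s n : ℕ}
    (P : Program L T (Fin s) (Bits n)) (v : T) (x : NodeData L) : Prop :=
  (∀ σ : Fin s, σ ∈ P.code v ↔ (σ : ℕ) ∈ x.1) ∧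
  ∃ ts : List (L.Term Unit), x.2.1 = ts.map Term.listEncode ∧
    ∀ σ : Fin s, P.sem σ v =
      {p | ((σ : ℕ), readTerms v ts p.1, readTerms v ts p.2) ∈ x.2.2 ∧
        ∀ w, (∀ t ∈ ts, termAt v t ≠ w) → p.1 w = p.2 w}

/-- `c` is the code of an algorithm that computes, from a node of `T`, finite data that describe
the program `P` at this node. -/
def Computes {L : FirstOrder.Language} {T : Type*} [L.Structure T] [Primcodable T]
    [Primcodable (FunSym L)] {s n : ℕ} (c : Nat.Partrec.Code)
    (P : Program L T (Fin s) (Bits n)) : Prop :=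
  ∀ v : T, ∃ x : NodeData L,
    c.eval (Encodable.encode v) = Part.some (Encodable.encode x) ∧ Describes P v x

/-- The inputs of the decision procedure. -/
abbrev Input := (ℕ × ℕ × ℕ) × (ℕ × ℕ) × List (ℕ × ℕ) × Nat.Partrec.Code

/-- The input that consists of the length `n` of the bit-vectors, the numbers `s` and `l` of
commands and locations, the two distinguished locations, the sources and targets of the
commands, and the code `c`. -/
def mkInput (n : ℕ) {s l : ℕ} (K : Control (Fin s) (Fin l)) (c : Nat.Partrec.Code) : Input :=
  ((n, s, l), (K.init, K.err), List.ofFn fun σ => ((K.src σ : ℕ), (K.tgt σ : ℕ)), c)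

end ParamTopo

open ParamTopo

/-! ### Closure properties of recursively enumerable predicates -/

attribute [fun_prop] Computable Primrec
attribute [fun_prop] Computable.id Computable.const Computable.comp Computable.pair
attribute [fun_prop] Primrec.id Primrec.const Primrec.comp Primrec.pair

section FunProp

variable {α β γ : Type*} [Primcodable α] [Primcodable β] [Primcodable γ]

@[fun_prop]
theorem Computable.fst_comp {f : α → β × γ} (hf : Computable f) : Computable fun a => (f a).1 :=
  Computable.fst.comp hf

@[fun_prop]
theorem Computable.snd_comp {f : α → β × γ} (hf : Computable f) : Computable fun a => (f a).2 :=
  Computable.snd.comp hf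

@[fun_prop]
theorem Computable.append_comp {f g : α → List β} (hf : Computable f) (hg : Computable g) :
    Computable fun a => f a ++ g a :=
  Computable.list_append.comp hf hg

@[fun_prop]
theorem Computable.cons_comp {f : α → β} {g : α → List β} (hf : Computable f)
    (hg : Computable g) : Computable fun a => f a :: g a :=
  Computable.list_cons.comp hf hg

@[fun_prop]
theorem Computable.length_comp {f : α → List β} (hf : Computable f) :
    Computable fun a => (f a).length :=
  Computable.list_length.comp hf

@[fun_prop]
theorem Computable.succ_comp {f : α → ℕ} (hf : Computable f) : Computable fun a => f a + 1 :=
  Computable.succ.comp hf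

@[fun_prop]
theorem Primrec.fst_comp {f : α → β × γ} (hf : Primrec f) : Primrec fun a => (f a).1 :=
  Primrec.fst.comp hf

@[fun_prop]
theorem Primrec.snd_comp {f : α → β × γ} (hf : Primrec f) : Primrec fun a => (f a).2 :=
  Primrec.snd.comp hf

end FunProp

namespace REPred

variable {α β γ : Type*} [Primcodable α] [Primcodable β] [Primcodable γ]

theorem exists_primrec {p : α → Prop} (hp : REPred p) :
    ∃ f : α → ℕ → Bool, Primrec₂ f ∧ ∀ a, p a ↔ ∃ k, f a k = true := by
  obtain ⟨c, hc⟩ := Nat.Partrec.Code.exists_code.1 hp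
  refine ⟨fun a k => (Nat.Partrec.Code.evaln k c (Encodable.encode a)).isSome, ?_, fun a => ?_⟩
  · have h : Primrec fun x : α × ℕ => ((x.2, c), Encodable.encode x.1) :=
      (Primrec.snd.pair (Primrec.const c)).pair (Primrec.encode.comp Primrec.fst)
    exact Primrec.option_isSome.comp (Nat.Partrec.Code.primrec_evaln.comp h)
  · have h1 : p a ↔ (c.eval (Encodable.encode a)).Dom := by
      rw [hc]
      simp [Encodable.encodek, Part.assert]
    rw [h1, Part.dom_iff_mem]
    simp only [Nat.Partrec.Code.evaln_complete, Option.isSome_iff_exists, Option.mem_def]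
    exact exists_comm

theorem of_primrec {p : α → Prop} (f : α → ℕ → Bool) (hf : Primrec₂ f)
    (h : ∀ a, p a ↔ ∃ k, f a k = true) : REPred p := by
  have h1 : Partrec fun a => Nat.rfind (f a : ℕ →. Bool) :=
    Partrec.rfind hf.to_comp.partrec₂
  refine h1.dom_re.of_eq fun a => ?_
  rw [h, Part.dom_iff_mem]
  constructor
  · rintro ⟨k, hk⟩
    obtain ⟨_, h⟩ := Nat.rfind_spec hk
    exact ⟨k, h⟩
  · rintro ⟨k, hk⟩
    obtain ⟨m, hm, -⟩ := Nat.rfind_min' hk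
    exact ⟨m, hm⟩

theorem exists_primrec_mono {p : α → Prop} (hp : REPred p) :
    ∃ f : α → ℕ → Bool, Primrec₂ f ∧ (∀ a j k, j ≤ k → f a j = true → f a k = true) ∧
      ∀ a, p a ↔ ∃ k, f a k = true := by
  classical
  obtain ⟨f, hf, h⟩ := hp.exists_primrec
  have hR : PrimrecRel fun (j : ℕ) (a : α) => f a j = true :=
    Primrec.eq.comp (hf.comp Primrec.snd Primrec.fst) (Primrec.const true)
  have hR' : PrimrecRel fun (a : α) (k : ℕ) => ∃ j ∈ List.range (k + 1), f a j = true :=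
    hR.exists_mem_list.comp (Primrec.list_range.comp (Primrec.succ.comp Primrec.snd)) Primrec.fst
  refine ⟨fun a k => decide (∃ j ∈ List.range (k + 1), f a j = true), by convert hR'.decide, ?_, fun a => ?_⟩
  · simp only [decide_eq_true_eq, List.mem_range]
    rintro a j k hjk ⟨i, hi, h⟩
    exact ⟨i, by omega, h⟩
  · simp only [decide_eq_true_eq, List.mem_range, h]
    exact ⟨fun ⟨k, hk⟩ => ⟨k, k, by omega, hk⟩, fun ⟨_, k, _, hk⟩ => ⟨k, hk⟩⟩

theorem comp {p : β → Prop} (hp : REPred p) {f : α → β} (hf : Computable f) :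
    REPred fun a => p (f a) :=
  Partrec.comp hp hf

theorem and {p q : α → Prop} (hp : REPred p) (hq : REPred q) : REPred fun a => p a ∧ q a := by
  refine (Partrec.dom_re (Partrec.bind hp (hq.comp Computable.fst).to₂)).of_eq fun a => ?_
  simp [Part.bind_dom, Part.assert]

theorem or {p q : α → Prop} (hp : REPred p) (hq : REPred q) : REPred fun a => p a ∨ q a := by
  obtain ⟨k, hk, h⟩ := Partrec.merge' hp hq
  refine hk.dom_re.of_eq fun a => ?_
  rw [(h a).2]
  simp [Part.assert]

theorem exists_of {p : α × β → Prop} (hp : REPred p) : REPred fun a => ∃ b, p (a, b) := by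
  obtain ⟨f, hf, h⟩ := hp.exists_primrec
  refine of_primrec (fun a m => Option.casesOn (Encodable.decode (α := β) m.unpair.1) false
    fun b => f (a, b) m.unpair.2) ?_ fun a => ?_
  · have h1 : Primrec fun x : α × ℕ => Encodable.decode (α := β) x.2.unpair.1 :=
      Primrec.decode.comp (Primrec.fst.comp (Primrec.unpair.comp Primrec.snd))
    have h2 : Primrec fun y : (α × ℕ) × β => f (y.1.1, y.2) y.1.2.unpair.2 :=
      hf.comp (Primrec.pair (Primrec.fst.comp Primrec.fst) Primrec.snd)
        (Primrec.snd.comp (Primrec.unpair.comp (Primrec.snd.comp Primrec.fst)))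
    exact Primrec.option_casesOn h1 (Primrec.const false) h2.to₂
  · simp only [h]
    constructor
    · rintro ⟨b, k, hk⟩
      exact ⟨Nat.pair (Encodable.encode b) k, by simpa using hk⟩
    · rintro ⟨m, hm⟩
      cases hb : Encodable.decode (α := β) m.unpair.1 with
      | none => simp [hb] at hm
      | some b => exact ⟨b, m.unpair.2, by simpa [hb] using hm⟩

theorem exists_right {p : α → β → Prop} (hp : REPred fun x : α × β => p x.1 x.2) :
    REPred fun a => ∃ b, p a b :=
  exists_of hp

theorem eq {f g : α → β} (hf : Computable f) (hg : Computable g) : REPred fun a => f a = g a := by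
  have h : REPred fun x : β × β => x.1 = x.2 :=
    (Primrec.eq (α := β)).computablePred.to_re
  exact h.comp (hf.pair hg)

theorem ne {f g : α → β} (hf : Computable f) (hg : Computable g) : REPred fun a => f a ≠ g a := by
  have h : REPred fun x : β × β => ¬ x.1 = x.2 :=
    (Primrec.eq (α := β)).not.computablePred.to_re
  exact h.comp (hf.pair hg)

theorem lt {f g : α → ℕ} (hf : Computable f) (hg : Computable g) : REPred fun a => f a < g a := by
  have h : REPred fun x : ℕ × ℕ => x.1 < x.2 := Primrec.nat_lt.computablePred.to_re
  exact h.comp (hf.pair hg)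

theorem mem {f : α → β} {l : α → List β} (hf : Computable f) (hl : Computable l) :
    REPred fun a => f a ∈ l a := by
  have h : REPred fun x : List β × β => ∃ b ∈ x.1, b = x.2 :=
    (PrimrecRel.exists_mem_list (Primrec.eq (α := β))).computablePred.to_re
  exact (h.comp (hl.pair hf)).of_eq fun a => by simp

theorem exists_mem {l : α → List β} {p : α → β → Prop} (hl : Computable l)
    (hp : REPred fun x : α × β => p x.1 x.2) : REPred fun a => ∃ b ∈ l a, p a b :=
  (exists_right (p := fun a b => b ∈ l a ∧ p a b)
    ((mem Computable.snd (hl.comp Computable.fst)).and hp))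

theorem forall_mem {l : α → List β} {p : α → β → Prop} (hl : Computable l)
    (hp : REPred fun x : α × β => p x.1 x.2) : REPred fun a => ∀ b ∈ l a, p a b := by
  classical
  obtain ⟨f, hf, hmono, h⟩ := hp.exists_primrec_mono
  have hR : PrimrecRel fun (b : β) (y : α × ℕ) => f (y.1, b) y.2 = true :=
    Primrec.eq.comp (hf.comp (Primrec.pair (Primrec.fst.comp Primrec.snd) Primrec.fst)
      (Primrec.snd.comp Primrec.snd)) (Primrec.const true)
  have hR' : PrimrecRel fun (x : α × List β) (k : ℕ) => ∀ b ∈ x.2, f (x.1, b) k = true :=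
    hR.forall_mem_list.comp (Primrec.snd.comp Primrec.fst)
      (Primrec.pair (Primrec.fst.comp Primrec.fst) Primrec.snd)
  have key : REPred fun x : α × List β => ∀ b ∈ x.2, p x.1 b := by
    refine of_primrec _ hR'.decide fun x => ?_
    obtain ⟨a, L⟩ := x
    simp only [decide_eq_true_eq]
    constructor
    · intro hL
      induction L with
      | nil => exact ⟨0, by simp⟩
      | cons b L ih =>
        obtain ⟨k, hk⟩ := ih fun b hb => hL b (List.mem_cons_of_mem _ hb)
        obtain ⟨j, hj⟩ := (h (a, b)).1 (hL b List.mem_cons_self)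
        refine ⟨max j k, fun b' hb' => ?_⟩
        rcases List.mem_cons.1 hb' with rfl | hb'
        · exact hmono _ _ _ (le_max_left _ _) hj
        · exact hmono _ _ _ (le_max_right _ _) (hk b' hb')
    · rintro ⟨k, hk⟩ b hb
      exact (h (a, b)).2 ⟨k, hk b hb⟩
  exact key.comp (Computable.id.pair hl)

/-- Values of a computable Boolean function are recursively enumerable. -/
theorem of_bool {f : α → Bool} (hf : Computable f) (b : Bool) : REPred fun a => f a = b :=
  eq hf (Computable.const b)

theorem reflTransGen {r : α → β → β → Prop} (hr : REPred fun x : α × β × β => r x.1 x.2.1 x.2.2)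
    {f g : γ → β} {h : γ → α} (hh : Computable h) (hf : Computable f) (hg : Computable g) :
    REPred fun c => Relation.ReflTransGen (r (h c)) (f c) (g c) := by
  -- a derivation is a list of pairs `(b, k)`, where `k` bounds the number of steps to `b`
  have key : ∀ (a : α) (b₀ b : β), Relation.ReflTransGen (r a) b₀ b ↔
      ∃ l : List (ℕ × β), (∃ z ∈ l, z.2 = b) ∧ ∀ z ∈ l, (z.2 = b₀) ∨
        ∃ y ∈ l, y.1 < z.1 ∧ r a y.2 z.2 := by
    intro a b₀ b
    constructor
    · intro hb
      suffices ∃ l : List (ℕ × β), ∃ m, (m, b) ∈ l ∧ (∀ z ∈ l, z.1 ≤ m) ∧ ∀ z ∈ l, (z.2 = b₀) ∨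
          ∃ y ∈ l, y.1 < z.1 ∧ r a y.2 z.2 by
        obtain ⟨l, m, hm, _, hl⟩ := this
        exact ⟨l, ⟨_, hm, rfl⟩, hl⟩
      induction hb with
      | refl => exact ⟨[(0, b₀)], 0, by simp⟩
      | @tail b c _ hbc ih =>
        obtain ⟨l, m, hm, hmax, hl⟩ := ih
        refine ⟨(m + 1, c) :: l, m + 1, by simp, ?_, ?_⟩
        · intro z hz
          rcases List.mem_cons.1 hz with rfl | hz
          · exact le_rfl
          · exact (hmax z hz).trans (Nat.le_succ m)
        · intro z hz
          rcases List.mem_cons.1 hz with rfl | hz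
          · exact Or.inr ⟨_, List.mem_cons_of_mem _ hm, Nat.lt_succ_self m, hbc⟩
          · exact (hl z hz).imp_right fun ⟨y, hy, h⟩ => ⟨y, List.mem_cons_of_mem _ hy, h⟩
    · rintro ⟨l, ⟨z, hz, rfl⟩, hl⟩
      obtain ⟨m, hm⟩ : ∃ m, z.1 = m := ⟨_, rfl⟩
      induction m using Nat.strong_induction_on generalizing z with
      | _ m ih =>
        rcases hl z hz with h | ⟨y, hy, hlt, hr⟩
        · rw [h]
        · exact (ih y.1 (hm ▸ hlt) y hy rfl).tail hr
  have h1 : REPred fun x : α × β × β => ∃ l : List (ℕ × β), (∃ z ∈ l, z.2 = x.2.2) ∧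
      ∀ z ∈ l, (z.2 = x.2.1) ∨ ∃ y ∈ l, y.1 < z.1 ∧ r x.1 y.2 z.2 := by
    refine exists_right (and (exists_mem (by fun_prop) (eq (by fun_prop) (by fun_prop))) ?_)
    refine forall_mem (by fun_prop) (or (eq (by fun_prop) (by fun_prop)) ?_)
    refine exists_mem (by fun_prop) (and (lt (by fun_prop) (by fun_prop)) ?_)
    exact hr.comp (f := fun x : (((α × β × β) × List (ℕ × β)) × ℕ × β) × ℕ × β =>
      (x.1.1.1.1, x.2.2, x.1.2.2)) (by fun_prop)
  exact (h1.comp (hh.pair (hf.pair hg))).of_eq fun c => (key _ _ _).symm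

/-- Searching for a proof of one of two recursively enumerable predicates decides them wherever
they are complementary. -/
theorem exists_decide {p q : α → Prop} (hp : REPred p) (hq : REPred q) :
    ∃ d : α →. Bool, Partrec d ∧ ∀ a, (q a ↔ ¬ p a) → ∃ b ∈ d a, (b = true ↔ p a) := by
  obtain ⟨d, hd, h⟩ := Partrec.merge' (hp.map (Computable.const true).to₂)
    (hq.map (Computable.const false).to₂)
  refine ⟨d, hd, fun a ha => ?_⟩
  obtain ⟨h1, h2⟩ := h a
  have hdom : (d a).Dom := by
    rw [h2]
    by_cases hpa : p a
    · exact Or.inl ⟨hpa, trivial⟩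
    · exact Or.inr ⟨ha.2 hpa, trivial⟩
  obtain ⟨b, hb⟩ := Part.dom_iff_mem.1 hdom
  refine ⟨b, hb, ?_⟩
  rcases h1 b hb with hb | hb
  · simp only [Part.mem_map_iff, Part.mem_assert_iff] at hb
    obtain ⟨_, ⟨hpa, _⟩, rfl⟩ := hb
    simp [hpa]
  · simp only [Part.mem_map_iff, Part.mem_assert_iff] at hb
    obtain ⟨_, ⟨hqa, _⟩, rfl⟩ := hb
    simp [ha.1 hqa]

end REPred


namespace ParamTopo

open FirstOrder.Language
open scoped FirstOrder

/-! ### Local symmetry in homogeneous structures -/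

section Homogeneous

variable {L : FirstOrder.Language} {T : Type*} [L.Structure T] {d : ℕ}

theorem map_nbhd {T' : Type*} [L.Structure T'] (π : T ↪[L] T') (a : Fin d → T) :
    (nbhd L a).map π.toHom = nbhd L (fun i => π (a i)) := by
  rw [nbhd, ← FirstOrder.Language.Substructure.closure_image, ← Set.range_comp]
  rfl

/-- An embedding restricts to a local isomorphism. -/
noncomputable def embLocalIso {T' : Type*} [L.Structure T'] (π : T ↪[L] T') (a : Fin d → T) :
    LocalIso L a (fun i => π (a i)) := by
  have h := map_nbhd π a
  refine ⟨(h ▸ π.substructureEquivMap (nbhd L a) : nbhd L a ≃[L] nbhd L fun i => π (a i)), ?_⟩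
  intro i
  have : ∀ (S : L.Substructure T') (hS : (nbhd L a).map π.toHom = S),
      ((hS ▸ π.substructureEquivMap (nbhd L a) : nbhd L a ≃[L] S) ⟨a i, mem_nbhd L a i⟩ : T') =
        π (a i) := by
    rintro S rfl
    rfl
  exact this _ h

theorem locSymm_iff_exists_equiv (hhom : L.IsUltrahomogeneous T) (a b : Fin d → T) :
    LocSymm L a b ↔ ∃ π : T ≃[L] T, ∀ i, π (a i) = b i := by
  constructor
  · rintro ⟨β⟩
    obtain ⟨π, hπ⟩ := hhom (nbhd L a)
      ((Substructure.fg_def).2 ⟨Set.range a, Set.finite_range a, rfl⟩)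
      ((nbhd L b).subtype.comp β.toEquiv.toEmbedding)
    refine ⟨π, fun i => ?_⟩
    have := DFunLike.congr_fun hπ ⟨a i, mem_nbhd L a i⟩
    rw [← β.map_tuple i]
    exact this.symm
  · rintro ⟨π, hπ⟩
    obtain rfl : (fun i => π (a i)) = b := funext hπ
    exact ⟨embLocalIso π.toEmbedding a⟩

end Homogeneous

/-! ### Formulas as words -/

section Words

variable {L : FirstOrder.Language} {T α β : Type*} [L.Structure T]

theorem listEncode_relabel (r : α → β) (t : L.Term α) :
    (t.relabel r).listEncode = t.listEncode.map (Sum.map r id) := by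
  induction t with
  | var => rfl
  | func f ts ih =>
    simp only [Term.relabel, Term.listEncode, List.map_cons, List.map_flatMap, ih]
    rfl

theorem listEncode_subst_var (r : α → β) (t : L.Term α) :
    (t.subst fun a => Term.var (r a)).listEncode = t.listEncode.map (Sum.map r id) := by
  induction t with
  | var => rfl
  | func f ts ih =>
    simp only [Term.subst, Term.listEncode, List.map_cons, List.map_flatMap, ih]
    rfl

/-- Renaming of the free variables in a word. -/
def renameTok (r : α → β) : Tok L α → Tok L β :=
  Sum.map (Sum.map (Sum.map r id) id) id

theorem map_renameTok_termWord {α' : Type*} (r : α → α') (g : β → α) {n : ℕ}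
    (t : L.Term (β ⊕ Fin n)) :
    (termWord g t).map (renameTok r) = termWord (r ∘ g) t := by
  simp only [termWord, List.map_map]
  refine List.map_congr_left fun x _ => ?_
  rcases x with (x | x) | x <;> rfl

theorem map_renameTok_formulaWord {α' : Type*} (r : α → α') (g : β → α) {n : ℕ}
    (φ : L.BoundedFormula β n) :
    (formulaWord g φ).map (renameTok r) = formulaWord (r ∘ g) φ := by
  induction φ with
  | falsum => rfl
  | equal t u =>
    simp only [formulaWord, List.map_cons, List.map_append, map_renameTok_termWord]
    rfl
  | rel R ts =>
    simp only [formulaWord, List.map_cons, List.map_flatMap, map_renameTok_termWord]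
    rfl
  | imp φ ψ ih₁ ih₂ =>
    simp only [formulaWord, List.map_cons, List.map_append, ih₁, ih₂]
    rfl
  | all φ ih =>
    simp only [formulaWord, List.map_cons, ih]
    rfl

theorem termWord_rename (r : β → α) {n : ℕ} (t : L.Term (β ⊕ Fin n)) :
    termWord id (t.subst (Sum.elim
      (Term.relabel Sum.inl ∘ fun b => (Term.var (r b) : L.Term α)) (Term.var ∘ Sum.inr))) =
      termWord r t := by
  have h : (Sum.elim (Term.relabel Sum.inl ∘ fun b => (Term.var (r b) : L.Term α))
      (Term.var ∘ Sum.inr) : β ⊕ Fin n → L.Term (α ⊕ Fin n)) =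
      fun x => Term.var (Sum.map r id x) := by
    funext x
    cases x <;> rfl
  rw [h, termWord, listEncode_subst_var, termWord, List.map_map]
  refine List.map_congr_left fun x _ => ?_
  rcases x with (x | x) | x <;> rfl

theorem formulaWord_rename (r : β → α) {n : ℕ} (φ : L.BoundedFormula β n) :
    formulaWord id (φ.subst fun b => (Term.var (r b) : L.Term α)) = formulaWord r φ := by
  induction φ with
  | falsum => rfl
  | equal t u =>
    simp only [BoundedFormula.subst, BoundedFormula.mapTermRel, formulaWord, termWord_rename]
  | rel R ts =>
    simp only [BoundedFormula.subst, BoundedFormula.mapTermRel, formulaWord, termWord_rename, id]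
  | imp φ ψ ih₁ ih₂ =>
    simp only [BoundedFormula.subst, BoundedFormula.mapTermRel, formulaWord] at ih₁ ih₂ ⊢
    rw [ih₁, ih₂]
  | all φ ih =>
    simp only [BoundedFormula.subst, BoundedFormula.mapTermRel, formulaWord, id] at ih ⊢
    rw [ih]

theorem isQF_subst {n : ℕ} {φ : L.BoundedFormula β n} (h : φ.IsQF) (f : β → L.Term α) :
    (φ.subst f).IsQF := by
  induction h with
  | falsum => exact BoundedFormula.IsQF.falsum
  | of_isAtomic h =>
    cases h with
    | equal t u => exact (BoundedFormula.IsAtomic.equal _ _).isQF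
    | rel R ts => exact (BoundedFormula.IsAtomic.rel _ _).isQF
  | imp _ _ ih₁ ih₂ => exact ih₁.imp ih₂

/-- The node or the free variable that stands for the `i`-th variable if the list `a` of nodes is
substituted for the first variables. -/
def lookupVar (a : List T) (i : ℕ) : T ⊕ ℕ := (a[i]?).elim (Sum.inr i) Sum.inl

/-- The substitution of a list of nodes for the first free variables in a word. -/
def substWord (a : List T) (w : List (Tok L ℕ)) : List (Tok L (T ⊕ ℕ)) :=
  w.map (renameTok (lookupVar a))

/-- The word of the equation `w = t(v)`, where `t` is a term in one variable, as a word. -/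
def eqWord (w v : T) (t : List (Unit ⊕ FunSym L)) : List (Tok L (T ⊕ ℕ)) :=
  Sum.inr (Sum.inr 1) :: Sum.inl (Sum.inl (Sum.inl (Sum.inl w))) ::
    t.map fun x => Sum.inl (x.map (fun _ => Sum.inl (Sum.inl v)) id)

/-- The specification of an algorithm for `DecidableSat`. -/
def SatOracle (S : List (Tok L (T ⊕ ℕ)) → Bool) : Prop :=
  ∀ φ : L.Formula (T ⊕ ℕ), φ.IsQF →
    (S (formulaWord id φ) = true ↔ ∃ v : ℕ → T, φ.Realize (Sum.elim id v))

/-- The specification of an algorithm for `ComputableClasses`. -/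
def ClassOracle (L : FirstOrder.Language) (T : Type*) [L.Structure T]
    (E : ℕ → List (List (Tok L ℕ))) : Prop :=
  ∀ d : ℕ, 0 < d → ∃ Φ : List (L.Formula (Fin d)),
    E d = Φ.map (fun φ => formulaWord Fin.val φ) ∧
    (∀ φ ∈ Φ, φ.IsQF ∧ ∃ a : Fin d → T, ∀ b : Fin d → T, φ.Realize b ↔ LocSymm L a b) ∧
    ∀ a : Fin d → T, ∃ φ ∈ Φ, φ.Realize a

variable {S : List (Tok L (T ⊕ ℕ)) → Bool} (hS : SatOracle S)
include hS

theorem SatOracle.substWord_iff (a : List T) {d : ℕ} {φ : L.Formula (Fin d)} (hφ : φ.IsQF) :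
    S (substWord a (formulaWord Fin.val φ)) = true ↔
      ∃ v : ℕ → T, φ.Realize fun i => Sum.elim id v (lookupVar a i) := by
  rw [substWord, map_renameTok_formulaWord, ← formulaWord_rename, hS _ (isQF_subst hφ _)]
  simp only [Formula.Realize, BoundedFormula.realize_subst]
  rfl

theorem SatOracle.substWord_iff_realize (a : List T) {d : ℕ} (ha : a.length = d)
    {φ : L.Formula (Fin d)} (hφ : φ.IsQF) (hd : 0 < d) :
    S (substWord a (formulaWord Fin.val φ)) = true ↔
      φ.Realize fun i => a[(i : ℕ)]'(by omega) := by
  rw [hS.substWord_iff a hφ]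
  have h : ∀ v : ℕ → T, (fun i : Fin d => Sum.elim id v (lookupVar a i)) =
      fun i : Fin d => a[(i : ℕ)]'(by omega) := by
    intro v
    funext i
    have hi : (i : ℕ) < a.length := by omega
    simp [lookupVar, hi]
  simp only [h]
  exact ⟨fun ⟨_, h⟩ => h, fun h => ⟨fun _ => a[0]'(by omega), h⟩⟩

theorem SatOracle.substWord_iff_exists (a : List T) {φ : L.Formula (Fin (a.length + 1))}
    (hφ : φ.IsQF) :
    S (substWord a (formulaWord Fin.val φ)) = true ↔
      ∃ v : T, S (substWord (a ++ [v]) (formulaWord Fin.val φ)) = true := by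
  simp only [hS.substWord_iff_realize (a ++ [_]) (by simp) hφ (Nat.succ_pos _)]
  rw [hS.substWord_iff a hφ]
  have h : ∀ v : ℕ → T, (fun i : Fin (a.length + 1) => Sum.elim id v (lookupVar a i)) =
      fun i : Fin (a.length + 1) => (a ++ [v a.length])[(i : ℕ)]'(by simpa using Nat.le_of_lt_succ i.2) := by
    intro v
    funext i
    rcases Nat.lt_succ_iff_lt_or_eq.1 i.2 with hi | hi
    · simp [lookupVar, hi]
    · simp [lookupVar, hi]
  simp only [h]
  exact ⟨fun ⟨v, hv⟩ => ⟨v a.length, hv⟩, fun ⟨v, hv⟩ => ⟨fun _ => v, hv⟩⟩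

theorem SatOracle.eqWord_iff (w v : T) (t : L.Term Unit) :
    S (eqWord w v t.listEncode) = true ↔ w = termAt v t := by
  let u : L.Term ((T ⊕ ℕ) ⊕ Fin 0) := t.relabel fun _ => Sum.inl (Sum.inl v)
  let x : L.Term ((T ⊕ ℕ) ⊕ Fin 0) := Term.var (Sum.inl (Sum.inl w))
  have h : eqWord w v t.listEncode =
      formulaWord id (x.bdEqual u : L.Formula (T ⊕ ℕ)) := by
    simp only [Term.bdEqual, formulaWord, eqWord, x, u, termWord, listEncode_relabel,
      Term.listEncode, List.map_cons, List.map_map, List.map_nil, List.cons_append,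
      List.nil_append]
    congr 2
    refine List.map_congr_left fun y _ => ?_
    cases y <;> rfl
  rw [h, hS _ (BoundedFormula.IsAtomic.equal _ _).isQF]
  have h2 : ((termAt v t : nodeNbhd L v) : T) = t.realize fun _ => v := by
    rw [termAt]
    exact (FirstOrder.Language.HomClass.realize_term (nodeNbhd L v).subtype).symm
  simp only [Formula.Realize, BoundedFormula.realize_bdEqual, x, u, Term.realize_relabel, h2]
  exact ⟨fun ⟨_, h⟩ => h, fun h => ⟨fun _ => v, h⟩⟩

/-- Two lists of nodes satisfy the same formula of the list `E`. -/
def SameClass (S : List (Tok L (T ⊕ ℕ)) → Bool) (E : ℕ → List (List (Tok L ℕ)))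
    (a b : List T) : Prop :=
  a.length = b.length ∧ 0 < a.length ∧
    ∃ w ∈ E a.length, S (substWord a w) = true ∧ S (substWord b w) = true

theorem sameClass_iff {E : ℕ → List (List (Tok L ℕ))} (hE : ClassOracle L T E)
    (hhom : L.IsUltrahomogeneous T) (a b : List T) (ha : a ≠ []) :
    SameClass S E a b ↔ ∃ π : T ≃[L] T, a.map π = b := by
  have hpos : 0 < a.length := List.length_pos_iff.2 ha
  obtain ⟨Φ, hΦ, hcl, hall⟩ := hE a.length hpos
  constructor
  · rintro ⟨hlen, -, w, hw, hwa, hwb⟩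
    rw [hΦ, List.mem_map] at hw
    obtain ⟨φ, hφ, rfl⟩ := hw
    obtain ⟨hqf, c, hc⟩ := hcl φ hφ
    rw [hS.substWord_iff_realize a rfl hqf hpos, hc, locSymm_iff_exists_equiv hhom] at hwa
    rw [hS.substWord_iff_realize b hlen.symm hqf hpos, hc, locSymm_iff_exists_equiv hhom] at hwb
    obtain ⟨π, hπ⟩ := hwa
    obtain ⟨ρ, hρ⟩ := hwb
    refine ⟨ρ.comp π.symm, List.ext_getElem (by simpa using hlen) fun i h1 h2 => ?_⟩
    have h1' : i < a.length := by simpa using h1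
    have e1 := hπ ⟨i, h1'⟩
    have e2 := hρ ⟨i, h1'⟩
    simp only [List.getElem_map]
    rw [← e2, ← e1]
    simp
  · rintro ⟨π, rfl⟩
    obtain ⟨φ, hφ, hr⟩ := hall fun i => a[(i : ℕ)]
    obtain ⟨hqf, c, hc⟩ := hcl φ hφ
    refine ⟨by simp, hpos, _, hΦ ▸ List.mem_map_of_mem hφ, ?_, ?_⟩
    · rwa [hS.substWord_iff_realize a rfl hqf hpos]
    · rw [hS.substWord_iff_realize (a.map π) (by simp) hqf hpos, hc,
        locSymm_iff_exists_equiv hhom]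
      rw [hc, locSymm_iff_exists_equiv hhom] at hr
      obtain ⟨ρ, hρ⟩ := hr
      exact ⟨π.comp ρ, fun i => by simp [hρ i]⟩

/-- Every formula of the list `E` that is satisfiable over `a` is satisfied by a node of `vs`. -/
def CoversNodes (S : List (Tok L (T ⊕ ℕ)) → Bool) (E : ℕ → List (List (Tok L ℕ)))
    (a vs : List T) : Prop :=
  ∀ w ∈ E (a.length + 1), S (substWord a w) = false ∨
    ∃ v ∈ vs, S (substWord (a ++ [v]) w) = true

theorem CoversNodes.exists_equiv {E : ℕ → List (List (Tok L ℕ))} (hE : ClassOracle L T E)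
    (hhom : L.IsUltrahomogeneous T) {a vs : List T} (h : CoversNodes S E a vs) (v : T) :
    ∃ u ∈ vs, ∃ π : T ≃[L] T, (∀ x ∈ a, π x = x) ∧ π v = u := by
  obtain ⟨Φ, hΦ, hcl, hall⟩ := hE (a.length + 1) (Nat.succ_pos _)
  obtain ⟨φ, hφ, hr⟩ := hall fun i => (a ++ [v])[(i : ℕ)]'(by simpa using Nat.le_of_lt_succ i.2)
  obtain ⟨hqf, -⟩ := hcl φ hφ
  have hmem : formulaWord Fin.val φ ∈ E (a.length + 1) := hΦ ▸ List.mem_map_of_mem hφ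
  have hv : S (substWord (a ++ [v]) (formulaWord Fin.val φ)) = true :=
    (hS.substWord_iff_realize (a ++ [v]) (by simp) hqf (Nat.succ_pos _)).2 hr
  rcases h _ hmem with hf | ⟨u, hu, hu'⟩
  · have := (hS.substWord_iff_exists a hqf).2 ⟨v, hv⟩
    simp [this] at hf
  · obtain ⟨π, hπ⟩ := (sameClass_iff hS hE hhom (a ++ [v]) (a ++ [u]) (by simp)).1
      ⟨by simp, by simp, _, by simpa using hmem, hv, hu'⟩
    rw [List.map_append] at hπ
    obtain ⟨h1, h2⟩ := List.append_inj hπ (by simp)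
    refine ⟨u, hu, π, fun x hx => ?_, by simpa using h2⟩
    exact List.map_inj_left.1 (h1.trans (List.map_id a).symm) x hx

theorem exists_coversNodes {E : ℕ → List (List (Tok L ℕ))} (hE : ClassOracle L T E)
    (a : List T) : ∃ vs, CoversNodes S E a vs := by
  classical
  obtain ⟨Φ, hΦ, hcl, -⟩ := hE (a.length + 1) (Nat.succ_pos _)
  have : ∀ l : List (L.Formula (Fin (a.length + 1))), (∀ φ ∈ l, φ.IsQF) → ∃ vs : List T,
      ∀ φ ∈ l, S (substWord a (formulaWord Fin.val φ)) = false ∨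
        ∃ v ∈ vs, S (substWord (a ++ [v]) (formulaWord Fin.val φ)) = true := by
    intro l
    induction l with
    | nil => exact fun _ => ⟨[], by simp⟩
    | cons φ l ih =>
      intro hl
      obtain ⟨vs, hvs⟩ := ih fun ψ hψ => hl ψ (List.mem_cons_of_mem _ hψ)
      by_cases h : S (substWord a (formulaWord Fin.val φ)) = true
      · obtain ⟨v, hv⟩ := (hS.substWord_iff_exists a (hl φ List.mem_cons_self)).1 h
        refine ⟨v :: vs, fun ψ hψ => ?_⟩
        rcases List.mem_cons.1 hψ with rfl | hψ
        · exact Or.inr ⟨v, List.mem_cons_self, hv⟩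
        · exact (hvs ψ hψ).imp_right fun ⟨u, hu, h⟩ => ⟨u, List.mem_cons_of_mem _ hu, h⟩
      · refine ⟨vs, fun ψ hψ => ?_⟩
        rcases List.mem_cons.1 hψ with rfl | hψ
        · exact Or.inl (by simpa using h)
        · exact hvs ψ hψ
  obtain ⟨vs, hvs⟩ := this Φ fun φ hφ => (hcl φ hφ).1
  refine ⟨vs, fun w hw => ?_⟩
  rw [hΦ, List.mem_map] at hw
  obtain ⟨φ, hφ, rfl⟩ := hw
  exact hvs φ hφ

end Words

end ParamTopo


namespace ParamTopo

open FirstOrder.Language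
open scoped FirstOrder

/-! ### Local isomorphisms of nodes -/

section NodeIsos

variable {L : FirstOrder.Language} {A B C : Type*} [L.Structure A] [L.Structure B]
  [L.Structure C] {d : ℕ}

/-- The inverse of a local isomorphism. -/
def LocalIso.symm {a : Fin d → A} {b : Fin d → B} (β : LocalIso L a b) : LocalIso L b a where
  toEquiv := β.toEquiv.symm
  map_tuple i := by
    have h : β.toEquiv ⟨a i, mem_nbhd L a i⟩ = ⟨b i, mem_nbhd L b i⟩ :=
      Subtype.ext (β.map_tuple i)
    rw [← h, FirstOrder.Language.Equiv.symm_apply_apply]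

/-- The composition of local isomorphisms. -/
def LocalIso.trans {a : Fin d → A} {b : Fin d → B} {c : Fin d → C} (β : LocalIso L a b)
    (γ : LocalIso L b c) : LocalIso L a c where
  toEquiv := γ.toEquiv.comp β.toEquiv
  map_tuple i := by
    have h : β.toEquiv ⟨a i, mem_nbhd L a i⟩ = ⟨b i, mem_nbhd L b i⟩ :=
      Subtype.ext (β.map_tuple i)
    rw [FirstOrder.Language.Equiv.comp_apply, h, γ.map_tuple i]

theorem mem_nodeNbhd_iff {v x : A} :
    x ∈ nodeNbhd L v ↔ ∃ t : L.Term Unit, (t.realize fun _ => v) = x := by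
  rw [nodeNbhd, nbhd, FirstOrder.Language.Substructure.mem_closure_iff_exists_term]
  constructor
  · rintro ⟨t, rfl⟩
    refine ⟨t.relabel fun _ => (), ?_⟩
    rw [Term.realize_relabel]
    congr 1
    funext y
    obtain ⟨i, hi⟩ := y.2
    simpa using hi
  · rintro ⟨t, rfl⟩
    refine ⟨t.relabel fun _ => ⟨v, 0, rfl⟩, ?_⟩
    rw [Term.realize_relabel]
    rfl

theorem coe_termAt (v : A) (t : L.Term Unit) :
    ((termAt v t : nodeNbhd L v) : A) = t.realize fun _ => v :=
  (FirstOrder.Language.HomClass.realize_term (nodeNbhd L v).subtype).symm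

theorem termAt_surjective (v : A) : Function.Surjective (termAt (L := L) v) := fun x => by
  obtain ⟨t, ht⟩ := mem_nodeNbhd_iff.1 x.2
  exact ⟨t, Subtype.ext ((coe_termAt v t).trans ht)⟩

theorem LocalIso.apply_termAt {a : A} {b : B} (β : NodeIso L a b) (t : L.Term Unit) :
    β.toEquiv (termAt a t) = termAt b t := by
  have h : β.toEquiv (nodeSelf L a) = nodeSelf L b := Subtype.ext (β.map_tuple 0)
  rw [termAt, ← FirstOrder.Language.HomClass.realize_term β.toEquiv, termAt]
  congr 1
  funext _
  exact h

/-- An embedding of a substructure is locally an isomorphism. -/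
theorem exists_nodeIso (S : L.Substructure A) (g : S ↪[L] B) (v : S) :
    Nonempty (NodeIso L (v : A) (g v)) := by
  have h1 : (fun i => S.subtype ((![v] : Fin 1 → S) i)) = ![(v : A)] := by
    funext i
    simp
  have h2 : (fun i => g ((![v] : Fin 1 → S) i)) = ![g v] := by
    funext i
    simp
  rw [NodeIso, ← h1, ← h2]
  exact ⟨(embLocalIso S.subtype ![v]).symm.trans (embLocalIso g ![v])⟩

theorem LocalIso.apply_eq {S : L.Substructure A} {g : S ↪[L] B} {v : S}
    (β : NodeIso L (v : A) (g v)) (x : S) (hx : (x : A) ∈ nodeNbhd L (v : A)) :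
    (β.toEquiv ⟨x, hx⟩ : B) = g x := by
  obtain ⟨t, ht⟩ := termAt_surjective (v : A) ⟨(x : A), hx⟩
  have hx' : x = t.realize fun _ => v := by
    apply Subtype.ext
    have := congrArg Subtype.val ht
    rw [coe_termAt] at this
    rw [← this]
    exact FirstOrder.Language.HomClass.realize_term S.subtype
  rw [← ht, β.apply_termAt, coe_termAt, hx', ← FirstOrder.Language.HomClass.realize_term g]
  rfl

theorem mem_pull {D : Type*} {a : A} {b : B} (β : NodeIso L a b)
    (R : Set ((nodeNbhd L b → D) × (nodeNbhd L b → D)))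
    (p : (nodeNbhd L a → D) × (nodeNbhd L a → D)) :
    p ∈ pull β R ↔ (p.1 ∘ β.toEquiv.symm, p.2 ∘ β.toEquiv.symm) ∈ R := by
  constructor
  · rintro ⟨q, hq, rfl⟩
    convert hq using 2 <;> funext x <;> simp
  · intro h
    refine ⟨_, h, ?_⟩
    refine Prod.ext ?_ ?_ <;> funext x <;> simp

end NodeIsos

/-! ### Simulation along embeddings -/

section Simulation

variable {L : FirstOrder.Language} {A B C : Type*} [L.Structure A] [L.Structure B]
  [L.Structure C] {Cmd Loc D : Type*}

/-- Locally symmetric nodes run the same code with the same semantics. -/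
def LocCompat (P : Program L A Cmd D) (Q : Program L B Cmd D) : Prop :=
  ∀ (a : A) (b : B) (β : NodeIso L a b), P.code a = Q.code b ∧
    ∀ σ, P.sem σ a = pull β (Q.sem σ b)

theorem LocCompat.symm {P : Program L A Cmd D} {Q : Program L B Cmd D} (h : LocCompat P Q) :
    LocCompat Q P := fun b a β => by
  obtain ⟨h1, h2⟩ := h a b β.symm
  refine ⟨h1.symm, fun σ => ?_⟩
  ext p
  rw [mem_pull, h2, mem_pull]
  change _ ↔ ((p.1 ∘ β.toEquiv.symm) ∘ β.toEquiv, (p.2 ∘ β.toEquiv.symm) ∘ β.toEquiv) ∈ _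
  have : ∀ f : nodeNbhd L b → D, (f ∘ β.toEquiv.symm) ∘ β.toEquiv = f := fun f => by
    funext x
    simp
  rw [this, this]

/-- A step of a program on states, which consist of a location map and a valuation. -/
def Step (K : Control Cmd Loc) (P : Program L A Cmd D) (e : Cmd × A)
    (s s' : (A → Loc) × (A → D)) : Prop :=
  P.LocStep K e s.1 s'.1 ∧ (s.2, s'.2) ∈ P.globalSem e

theorem Step.simulate {K : Control Cmd Loc} {P : Program L A Cmd D} {Q : Program L B Cmd D}
    (hPQ : LocCompat P Q) {S : L.Substructure A} (g : S ↪[L] B) {σ : Cmd} (v : S)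
    {s s' : (A → Loc) × (A → D)} (h : Step K P (σ, (v : A)) s s') {r : (B → Loc) × (B → D)}
    (hr : ∀ x : S, r.1 (g x) = s.1 x ∧ r.2 (g x) = s.2 x) :
    ∃ r', Step K Q (σ, g v) r r' ∧ ∀ x : S, r'.1 (g x) = s'.1 x ∧ r'.2 (g x) = s'.2 x := by
  classical
  obtain ⟨⟨hc, hsrc, htgt, hother⟩, hsem, hout⟩ := h
  obtain ⟨β⟩ := exists_nodeIso S g v
  have hle : nodeNbhd L (v : A) ≤ S := by
    rw [nodeNbhd, nbhd, FirstOrder.Language.Substructure.closure_le]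
    rintro _ ⟨i, rfl⟩
    simp
  have hg : ∀ y : nodeNbhd L (g v),
      g ⟨β.toEquiv.symm y, hle (β.toEquiv.symm y).2⟩ = (y : B) := fun y => by
    rw [← β.apply_eq _ (β.toEquiv.symm y).2]
    simp
  obtain ⟨hcode, hsem'⟩ := hPQ v (g v) β
  refine ⟨(Function.update r.1 (g v) (K.tgt σ), fun w =>
    if hw : w ∈ nodeNbhd L (g v) then s'.2 (β.toEquiv.symm ⟨w, hw⟩) else r.2 w),
    ⟨⟨hcode ▸ hc, (hr v).1.trans hsrc, by simp, fun u hu => by simp [hu]⟩, ?_, ?_⟩, ?_⟩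
  · change _ ∈ P.sem σ (v : A) at hsem
    rw [hsem' σ, mem_pull] at hsem
    convert hsem using 2
    · funext y
      change r.2 y = s.2 (β.toEquiv.symm y)
      rw [← hg y, (hr _).2]
    · funext y
      simp
  · intro w hw
    simp only at hw
    simp [hw]
  · intro x
    constructor
    · by_cases hx : x = v
      · subst hx
        simpa using htgt.symm
      · have h1 : g x ≠ g v := fun h => hx (g.injective h)
        have h2 : (x : A) ≠ v := fun h => hx (Subtype.ext h)
        simp only [Function.update_of_ne h1, (hr x).1]
        exact (hother _ h2).symm
    · by_cases hx : (x : A) ∈ nodeNbhd L (v : A)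
      · have h1 := β.apply_eq x hx
        have h2 : g x ∈ nodeNbhd L (g v) := h1 ▸ (β.toEquiv ⟨x, hx⟩).2
        have h3 : (⟨g x, h2⟩ : nodeNbhd L (g v)) = β.toEquiv ⟨x, hx⟩ := Subtype.ext h1.symm
        simp only [h2, dif_pos, h3]
        simp
      · have h2 : g x ∉ nodeNbhd L (g v) := fun h2 => by
          have h3 := hg ⟨g x, h2⟩
          have h4 := congrArg Subtype.val (g.injective h3)
          simp only at h4
          exact hx (h4 ▸ (β.toEquiv.symm ⟨g x, h2⟩).2)
        simp only [h2, dif_neg, not_false_iff, (hr x).2]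
        exact hout _ hx

/-- The word `ρ` leads from the state `s` to the state `s'`. -/
def Run (K : Control Cmd Loc) (P : Program L A Cmd D) :
    List (Cmd × A) → (A → Loc) × (A → D) → (A → Loc) × (A → D) → Prop
  | [], s, s' => s = s'
  | e :: ρ, s, s' => ∃ s₁, Step K P e s s₁ ∧ Run K P ρ s₁ s'

theorem run_iff {K : Control Cmd Loc} {P : Program L A Cmd D} {ρ : List (Cmd × A)}
    {s s' : (A → Loc) × (A → D)} :
    Run K P ρ s s' ↔ P.LocRun K ρ s.1 s'.1 ∧ (s.2, s'.2) ∈ P.globalRun ρ := by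
  induction ρ generalizing s with
  | nil => exact Prod.ext_iff
  | cons e ρ ih =>
    constructor
    · rintro ⟨s₁, ⟨h1, h2⟩, h⟩
      obtain ⟨h3, h4⟩ := ih.1 h
      exact ⟨⟨s₁.1, h1, h3⟩, ⟨s₁.2, h2, h4⟩⟩
    · rintro ⟨⟨lam, h1, h3⟩, ⟨mu, h2, h4⟩⟩
      exact ⟨(lam, mu), ⟨h1, h2⟩, ih.2 ⟨h3, h4⟩⟩

theorem not_safeFrom_iff {K : Control Cmd Loc} {P : Program L A Cmd D} {mu : A → D} :
    ¬ P.SafeFrom K {mu} ↔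
      ∃ ρ s u, Run K P ρ ((fun _ => K.init), mu) s ∧ s.1 u = K.err := by
  simp only [run_iff, Program.SafeFrom, Program.errRuns, Set.mem_ofPred_eq, Set.mem_singleton_iff]
  push Not
  constructor
  · rintro ⟨ρ, ⟨lam, h1, ⟨u, hu⟩⟩, _, rfl, mu', h2⟩
    exact ⟨ρ, (lam, mu'), u, ⟨h1, h2⟩, hu⟩
  · rintro ⟨ρ, s, u, ⟨h1, h2⟩, hu⟩
    exact ⟨ρ, ⟨s.1, h1, ⟨u, hu⟩⟩, mu, rfl, s.2, h2⟩

theorem not_safeFrom_iff_reflTransGen {K : Control Cmd Loc} {P : Program L A Cmd D}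
    {mu : A → D} :
    ¬ P.SafeFrom K {mu} ↔ ∃ s u, Relation.ReflTransGen (fun s s' => ∃ e, Step K P e s s')
      ((fun _ => K.init), mu) s ∧ s.1 u = K.err := by
  have h : ∀ s s', (∃ ρ, Run K P ρ s s') ↔
      Relation.ReflTransGen (fun s s' => ∃ e, Step K P e s s') s s' := by
    intro s s'
    constructor
    · rintro ⟨ρ, h⟩
      induction ρ generalizing s with
      | nil => exact h ▸ Relation.ReflTransGen.refl
      | cons e ρ ih =>
        obtain ⟨s₁, h1, h2⟩ := h
        exact (ih _ h2).head ⟨e, h1⟩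
    · intro h
      induction h using Relation.ReflTransGen.head_induction_on with
      | refl => exact ⟨[], rfl⟩
      | head h _ ih =>
        obtain ⟨e, he⟩ := h
        obtain ⟨ρ, hρ⟩ := ih
        exact ⟨e :: ρ, _, he, hρ⟩
  rw [not_safeFrom_iff]
  simp only [← h]
  exact ⟨fun ⟨ρ, s, u, h1, h2⟩ => ⟨s, u, ⟨ρ, h1⟩, h2⟩, fun ⟨s, u, ⟨ρ, h1⟩, h2⟩ => ⟨ρ, s, u, h1, h2⟩⟩

theorem Run.simulate {K : Control Cmd Loc} {P : Program L A Cmd D} {Q : Program L B Cmd D}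
    (hPQ : LocCompat P Q) {S : L.Substructure A} (g : S ↪[L] B) {ρ : List (Cmd × A)}
    (hρ : ∀ e ∈ ρ, e.2 ∈ S)
    {s s' : (A → Loc) × (A → D)} (h : Run K P ρ s s') {r : (B → Loc) × (B → D)}
    (hr : ∀ x : S, r.1 (g x) = s.1 x ∧ r.2 (g x) = s.2 x) :
    ∃ ρ' r', Run K Q ρ' r r' ∧ ∀ x : S, r'.1 (g x) = s'.1 x ∧ r'.2 (g x) = s'.2 x := by
  induction ρ generalizing s r with
  | nil =>
    obtain rfl : s = s' := h
    exact ⟨[], r, rfl, hr⟩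
  | cons e ρ ih =>
    obtain ⟨s₁, h1, h2⟩ := h
    obtain ⟨σ, v⟩ := e
    obtain ⟨r₁, hs, hr₁⟩ := h1.simulate hPQ g ⟨v, hρ _ List.mem_cons_self⟩ hr
    obtain ⟨ρ', r', h3, h4⟩ := ih (fun e he => hρ e (List.mem_cons_of_mem _ he)) h2 hr₁
    exact ⟨_ :: ρ', r', ⟨r₁, hs, h3⟩, h4⟩

/-- Unsafety is transferred along embeddings of all finitely generated substructures. -/
theorem not_safeFrom_transfer {K : Control Cmd Loc} {P : Program L A Cmd D}
    (d : D) (h : ¬ P.SafeFrom K {fun _ => d}) :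
    ∃ S : L.Substructure A, S.FG ∧ ∀ {B : Type*} [L.Structure B] (Q : Program L B Cmd D),
      LocCompat P Q → (S ↪[L] B) → ¬ Q.SafeFrom K {fun _ => d} := by
  classical
  obtain ⟨ρ, s, u, h1, h2⟩ := not_safeFrom_iff.1 h
  let F : Finset A := insert u (ρ.map Prod.snd).toFinset
  refine ⟨FirstOrder.Language.Substructure.closure L F,
    FirstOrder.Language.Substructure.fg_def.2 ⟨F, F.finite_toSet, rfl⟩, ?_⟩
  intro B _ Q hPQ g
  have hmem : ∀ x ∈ F, x ∈ FirstOrder.Language.Substructure.closure L (F : Set A) := fun x hx =>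
    FirstOrder.Language.Substructure.subset_closure hx
  obtain ⟨ρ', r', h3, h4⟩ := h1.simulate hPQ g
    (fun e he => hmem _ (Finset.mem_insert_of_mem (by simpa using ⟨e.1, he⟩)))
    (r := ((fun _ => K.init), fun _ => d)) (fun x => ⟨rfl, rfl⟩)
  exact not_safeFrom_iff.2 ⟨ρ', r', g ⟨u, hmem u (Finset.mem_insert_self _ _)⟩, h3,
    (h4 _).1.trans h2⟩

end Simulation

/-! ### The limit program -/

section Limit

variable {L : FirstOrder.Language} {T : Type*} [L.Structure T] {Cmd Loc D : Type*}

theorem locCompat_limitProgram (𝓟 : ParamProgram L Cmd D) (i : 𝓟.Index) :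
    LocCompat (limitProgram T 𝓟) (𝓟.prog i) := by
  intro v u β
  constructor
  · ext σ
    constructor
    · rintro ⟨j, w, ⟨γ⟩, hσ⟩
      rwa [𝓟.code_symm j i w u ⟨γ.symm.trans β⟩] at hσ
    · exact fun hσ => ⟨i, u, ⟨β⟩, hσ⟩
  · intro σ
    ext p
    constructor
    · rintro ⟨j, w, γ, hp⟩
      rw [mem_pull, 𝓟.sem_symm j i w u (γ.symm.trans β), mem_pull] at hp
      rw [mem_pull]
      convert hp using 2
      · funext x
        change p.1 _ = p.1 (γ.toEquiv.symm (γ.toEquiv (β.toEquiv.symm x)))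
        simp
      · funext x
        change p.2 _ = p.2 (γ.toEquiv.symm (γ.toEquiv (β.toEquiv.symm x)))
        simp
    · exact fun hp => ⟨i, u, β, hp⟩

theorem locCompat_limitProgram_self {𝓟 : ParamProgram L Cmd D} (hlim : IsLimit T 𝓟) :
    LocCompat (limitProgram T 𝓟) (limitProgram T 𝓟) := by
  intro a b β
  obtain ⟨i, ⟨g⟩⟩ := hlim.2 (nodeNbhd L b)
    (FirstOrder.Language.Substructure.fg_def.2 ⟨_, Set.finite_range _, rfl⟩)
  obtain ⟨γ⟩ := exists_nodeIso (nodeNbhd L b) g (nodeSelf L b)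
  change NodeIso L b _ at γ
  obtain ⟨h1, h2⟩ := locCompat_limitProgram (T := T) 𝓟 i b _ γ
  obtain ⟨h3, h4⟩ := locCompat_limitProgram (T := T) 𝓟 i a _ (β.trans γ)
  refine ⟨h3.trans h1.symm, fun σ => ?_⟩
  ext p
  rw [h4, h2, mem_pull, mem_pull, mem_pull]
  rfl

theorem safe_iff_limitProgram {n : ℕ} {𝓟 : ParamProgram L Cmd (Bits n)} (hlim : IsLimit T 𝓟)
    (K : Control Cmd Loc) :
    𝓟.Safe K ↔ (limitProgram T 𝓟).SafeFrom K {fun _ _ => false} := by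
  constructor
  · intro h
    by_contra hT
    obtain ⟨S, hS, hall⟩ := not_safeFrom_transfer (fun _ => false) hT
    obtain ⟨i, ⟨g⟩⟩ := hlim.2 S hS
    exact hall _ (locCompat_limitProgram 𝓟 i) g (h i)
  · intro h i
    by_contra hi
    obtain ⟨S, -, hall⟩ := not_safeFrom_transfer (fun _ => false) hi
    obtain ⟨g⟩ := hlim.1 i
    exact hall _ (locCompat_limitProgram 𝓟 i).symm (g.comp S.subtype) h

/-- Steps are invariant under automorphisms. -/
theorem Step.map_equiv {K : Control Cmd Loc} {P : Program L T Cmd D} (hP : LocCompat P P)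
    (π : T ≃[L] T) {σ : Cmd} {v : T} {s s' : (T → Loc) × (T → D)} (h : Step K P (σ, v) s s') :
    Step K P (σ, π v) (s.1 ∘ π.symm, s.2 ∘ π.symm) (s'.1 ∘ π.symm, s'.2 ∘ π.symm) := by
  let v' : (⊤ : L.Substructure T) := ⟨v, FirstOrder.Language.Substructure.mem_top v⟩
  let g : (⊤ : L.Substructure T) ↪[L] T := π.toEmbedding.comp (⊤ : L.Substructure T).subtype
  have hg : ∀ x, g x = π x := fun _ => rfl
  obtain ⟨r', h1, h2⟩ := Step.simulate hP g v' h (r := (s.1 ∘ π.symm, s.2 ∘ π.symm))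
    (fun x => by simp [hg])
  have : r' = (s'.1 ∘ π.symm, s'.2 ∘ π.symm) := by
    have h3 : ∀ y, r'.1 y = s'.1 (π.symm y) ∧ r'.2 y = s'.2 (π.symm y) := fun y => by
      have := h2 ⟨π.symm y, FirstOrder.Language.Substructure.mem_top _⟩
      simpa [hg] using this
    exact Prod.ext (funext fun y => (h3 y).1) (funext fun y => (h3 y).2)
  rw [← this]
  exact h1

end Limit

end ParamTopo


namespace ParamTopo

open FirstOrder.Language
open scoped FirstOrder

/-! ### Partial states as lists of assignments

A variable is a pair of a node and a Boolean, which selects the location or the data of the node;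
its values are coded by numbers. -/

/-- A list of assignments `(x, k)` of values to variables. -/
abbrev Cfg (T : Type*) := List ((T × Bool) × ℕ)

section Cfg

variable {T : Type*} {n l : ℕ}

/-- The value of a variable in a state. -/
def stateVal (s : (T → Fin l) × (T → Bits n)) (x : T × Bool) : ℕ :=
  if x.2 then Encodable.encode (List.ofFn (s.2 x.1)) else s.1 x.1

/-- The state `s` extends the partial state `C`. -/
def Sat (s : (T → Fin l) × (T → Bits n)) (C : Cfg T) : Prop :=
  ∀ p ∈ C, stateVal s p.1 = p.2

/-- The assignment of the location `k` to `v` and of the data `vals` to `ws`. -/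
def assign (k : ℕ) (v : T) (ws : List T) (vals : List (List Bool)) : Cfg T :=
  ((v, false), k) :: (ws.zip vals).map fun z => ((z.1, true), Encodable.encode z.2)

/-- No variable is assigned two values. -/
def Consistent (C : Cfg T) : Prop := ∀ p ∈ C, ∀ q ∈ C, p.1 = q.1 → p.2 = q.2

/-- The number `k` codes a location or a bit-vector. -/
def ValidVal (n l : ℕ) (y : Bool × ℕ) : Prop :=
  if y.1 then ∃ b : Bits n, Encodable.encode (List.ofFn b) = y.2 else y.2 < l

/-- The action of a map on partial states. -/
def moveCfg (f : T → T) (C : Cfg T) : Cfg T := C.map fun p => ((f p.1.1, p.1.2), p.2)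

theorem finite_validVal (n l : ℕ) : {y | ValidVal n l y}.Finite := by
  refine Set.Finite.subset (((Set.finite_range fun b : Bits n =>
    (true, Encodable.encode (List.ofFn b))).union
      ((Set.finite_lt_nat l).image fun k => (false, k)))) ?_
  rintro ⟨b, k⟩ h
  cases b with
  | false => exact Or.inr ⟨k, by simpa [ValidVal] using h, rfl⟩
  | true =>
    obtain ⟨b, hb⟩ : ∃ b : Bits n, Encodable.encode (List.ofFn b) = k := by
      simpa [ValidVal] using h
    exact Or.inl ⟨b, by simp [hb]⟩

theorem Sat.append {s : (T → Fin l) × (T → Bits n)} {C D : Cfg T} (hC : Sat s C) (hD : Sat s D) :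
    Sat s (C ++ D) := fun p hp => (List.mem_append.1 hp).elim (hC p) (hD p)

theorem Sat.consistent {s : (T → Fin l) × (T → Bits n)} {C : Cfg T} (h : Sat s C) :
    Consistent C := fun p hp q hq hpq => by rw [← h p hp, ← h q hq, hpq]

theorem Sat.move {s : (T → Fin l) × (T → Bits n)} {C : Cfg T} (h : Sat s C) {f g : T → T}
    (hfg : ∀ p ∈ C, g (f p.1.1) = p.1.1) : Sat (s.1 ∘ g, s.2 ∘ g) (moveCfg f C) := by
  intro p hp
  obtain ⟨q, hq, rfl⟩ := List.mem_map.1 hp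
  rw [← h q hq]
  simp [stateVal, hfg q hq]

theorem sat_assign_iff {s : (T → Fin l) × (T → Bits n)} {k : ℕ} {v : T} {ws : List T}
    {vals : List (List Bool)} (hlen : vals.length = ws.length) :
    Sat s (assign k v ws vals) ↔
      (s.1 v : ℕ) = k ∧ vals = ws.map fun w => List.ofFn (s.2 w) := by
  have h : (∀ z ∈ ws.zip vals, List.ofFn (s.2 z.1) = z.2) ↔
      vals = ws.map fun w => List.ofFn (s.2 w) := by
    induction ws generalizing vals with
    | nil => simpa using hlen
    | cons w ws ih =>
      cases vals with
      | nil => simp at hlen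
      | cons a vals =>
        have := ih (vals := vals) (by simpa using hlen)
        simp only [List.zip_cons_cons, List.forall_mem_cons, this, List.map_cons, List.cons.injEq]
        rw [@eq_comm _ a]
  rw [← h]
  simp only [Sat, assign, List.forall_mem_cons, List.forall_mem_map, stateVal, if_true,
    Encodable.encode_injective.eq_iff]
  simp

/-- Consistent assignments of coded values can be carried out. -/
theorem exists_update (s : (T → Fin l) × (T → Bits n)) {Q : Cfg T}
    (hv : ∀ p ∈ Q, ValidVal n l (p.1.2, p.2)) (hQ : Consistent Q) :
    ∃ s' : (T → Fin l) × (T → Bits n), Sat s' Q ∧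
      ∀ x, x ∉ Q.map Prod.fst → stateVal s' x = stateVal s x := by
  classical
  refine ⟨(fun u => if h : ∃ k : Fin l, ((u, false), (k : ℕ)) ∈ Q then h.choose else s.1 u,
    fun u => if h : ∃ b : Bits n, ((u, true), Encodable.encode (List.ofFn b)) ∈ Q
      then h.choose else s.2 u), ?_, ?_⟩
  · rintro ⟨⟨u, b⟩, k⟩ hp
    have hk := hv _ hp
    cases b with
    | false =>
      have hk : k < l := by simpa [ValidVal] using hk
      have h : ∃ k : Fin l, ((u, false), (k : ℕ)) ∈ Q := ⟨⟨k, hk⟩, hp⟩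
      simp only [stateVal, h, dif_pos]
      exact hQ _ h.choose_spec _ hp rfl
    | true =>
      obtain ⟨b, hb⟩ : ∃ b : Bits n, Encodable.encode (List.ofFn b) = k := by
        simpa [ValidVal] using hk
      have h : ∃ b : Bits n, ((u, true), Encodable.encode (List.ofFn b)) ∈ Q := ⟨b, hb ▸ hp⟩
      simp only [stateVal, h, dif_pos]
      exact hQ _ h.choose_spec _ hp rfl
  · rintro ⟨u, b⟩ hx
    cases b with
    | false =>
      have h : ¬ ∃ k : Fin l, ((u, false), (k : ℕ)) ∈ Q := fun ⟨k, hk⟩ =>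
        hx (List.mem_map.2 ⟨_, hk, rfl⟩)
      simp [stateVal, h]
    | true =>
      have h : ¬ ∃ b : Bits n, ((u, true), Encodable.encode (List.ofFn b)) ∈ Q := fun ⟨k, hk⟩ =>
        hx (List.mem_map.2 ⟨_, hk, rfl⟩)
      simp [stateVal, h]

/-- The partial state `D` contains the weakest precondition of `C` under the command that reads
`R` and writes `Q`. -/
def IsPre (R Q C D : Cfg T) : Prop :=
  (∀ p ∈ R, p ∈ D) ∧ ∀ p ∈ C, p ∈ D ∨ ∃ q ∈ Q, q.1 = p.1

/-- The partial state `D` is contained in the weakest precondition of `C` under the command that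
reads `R` and writes `Q`. -/
def BelowPre (R Q C D : Cfg T) : Prop :=
  ∀ p ∈ D, p ∈ R ∨ (p ∈ C ∧ ∀ q ∈ Q, q.1 ≠ p.1)

theorem BelowPre.sat {R Q C D : Cfg T} (h : BelowPre R Q C D)
    {s s' : (T → Fin l) × (T → Bits n)} (hR : Sat s R) (hC : Sat s' C)
    (hs : ∀ x, x ∉ Q.map Prod.fst → stateVal s' x = stateVal s x) : Sat s D := by
  intro p hp
  rcases h p hp with h | ⟨h, hq⟩
  · exact hR p h
  · rw [← hC p h, hs]
    intro hx
    obtain ⟨q, hq', hqp⟩ := List.mem_map.1 hx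
    exact hq q hq' hqp

theorem exists_pre (R Q C : Cfg T) : ∃ D, IsPre R Q C D ∧ BelowPre R Q C D := by
  classical
  refine ⟨R ++ C.filter fun p => decide (∀ q ∈ Q, q.1 ≠ p.1), ⟨?_, ?_⟩, ?_⟩
  · exact fun p hp => List.mem_append_left _ hp
  · intro p hp
    by_cases h : ∀ q ∈ Q, q.1 ≠ p.1
    · exact Or.inl (List.mem_append_right _ (List.mem_filter.2 ⟨hp, by simpa using h⟩))
    · push Not at h
      exact Or.inr h
  · intro p hp
    rcases List.mem_append.1 hp with h | h
    · exact Or.inl h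
    · obtain ⟨h1, h2⟩ := List.mem_filter.1 h
      exact Or.inr ⟨h1, by simpa using h2⟩

theorem IsPre.exists_sat {R Q C D : Cfg T} (h : IsPre R Q C D)
    (hv : ∀ p ∈ Q, ValidVal n l (p.1.2, p.2)) (hQC : Consistent (Q ++ C))
    {s : (T → Fin l) × (T → Bits n)} (hD : Sat s D) :
    Sat s R ∧ ∃ s' : (T → Fin l) × (T → Bits n), Sat s' Q ∧ Sat s' C ∧
      ∀ x, x ∉ Q.map Prod.fst → stateVal s' x = stateVal s x := by
  obtain ⟨s', h1, h2⟩ := exists_update s hv fun p hp q hq =>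
    hQC p (List.mem_append_left _ hp) q (List.mem_append_left _ hq)
  refine ⟨fun p hp => hD p (h.1 p hp), s', h1, fun p hp => ?_, h2⟩
  by_cases hx : p.1 ∈ Q.map Prod.fst
  · obtain ⟨q, hq, hqp⟩ := List.mem_map.1 hx
    rw [← hqp, h1 q hq]
    exact hQC q (List.mem_append_left _ hq) p (List.mem_append_right _ hp) hqp
  · rcases h.2 p hp with h | ⟨q, hq, hqp⟩
    · rw [h2 _ hx, hD p h]
    · exact absurd (List.mem_map.2 ⟨q, hq, hqp⟩) hx

end Cfg

/-! ### Commands as rows of tables -/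

/-- A row of the table of a node: command, old values, new values. -/
abbrev Row := ℕ × List (List Bool) × List (List Bool)

/-- A row of a table that describes a transition on `m` nodes. -/
def GoodRow (n s m : ℕ) (cmds : List ℕ) (row : Row) : Prop :=
  row.1 < s ∧ row.1 ∈ cmds ∧ row.2.1.length = m ∧ row.2.2.length = m ∧
    (∀ b ∈ row.2.1, b.length = n) ∧ ∀ b ∈ row.2.2, b.length = n

/-- The source and the target of a command. -/
def endpoints (i : Input) (σ : ℕ) : ℕ × ℕ := (i.2.2.1[σ]?).getD (0, 0)

theorem GoodRow.validVal {T : Type*} {n s l m : ℕ} {cmds : List ℕ} {row : Row} (h : GoodRow n s m cmds row)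
    {k : ℕ} (hk : k < l) (v : T) (ws : List T) {vals : List (List Bool)}
    (hvals : vals = row.2.1 ∨ vals = row.2.2) :
    ∀ p ∈ assign k v ws vals, ValidVal n l (p.1.2, p.2) := by
  obtain ⟨-, -, -, -, h1, h2⟩ := h
  intro p hp
  rcases List.mem_cons.1 hp with rfl | hp
  · simpa [ValidVal] using hk
  · obtain ⟨⟨w, b⟩, hz, rfl⟩ := List.mem_map.1 hp
    have hb : b.length = n := by
      have := (List.of_mem_zip hz).2
      rcases hvals with rfl | rfl
      · exact h1 b this
      · exact h2 b this
    subst hb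
    simp only [ValidVal, if_true]
    exact ⟨fun i => b[i], by congr 1; exact List.ofFn_getElem⟩

theorem values_iff {L : FirstOrder.Language} {T : Type*} [L.Structure T]
    {S : List (Tok L (T ⊕ ℕ)) → Bool} (hS : SatOracle S) (v : T) (ts : List (L.Term Unit)) (ws : List T) :
    (ws.length = (ts.map Term.listEncode).length ∧
      ∀ y ∈ ws.zip (ts.map Term.listEncode), S (eqWord y.1 v y.2) = true) ↔
      ws = ts.map fun t => (termAt v t : T) := by
  induction ts generalizing ws with
  | nil => simp
  | cons t ts ih =>
    cases ws with
    | nil => simp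
    | cons w ws =>
      simp only [List.map_cons, List.zip_cons_cons, List.forall_mem_cons, List.cons.injEq,
        List.length_cons, Nat.add_right_cancel_iff, hS.eqWord_iff, ← ih]
      tauto

section Data

variable {L : FirstOrder.Language} {T : Type*} [L.Structure T] [Primcodable T]
  [Primcodable (FunSym L)]

/-- The finite data `x` at the node `v`, and the nodes `ws` accessed there. -/
def HasData (S : List (Tok L (T ⊕ ℕ)) → Bool) (c : Nat.Partrec.Code) (v : T) (x : NodeData L)
    (ws : List T) : Prop :=
  Encodable.encode x ∈ c.eval (Encodable.encode v) ∧ ws.length = x.2.1.length ∧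
    ∀ y ∈ ws.zip x.2.1, S (eqWord y.1 v y.2) = true

variable {S : List (Tok L (T ⊕ ℕ)) → Bool} {n s l : ℕ} {c : Nat.Partrec.Code}
  {P : Program L T (Fin s) (Bits n)}

theorem exists_hasData (hS : SatOracle S) (hc : Computes c P) (v : T) :
    ∃ x ws, HasData S c v x ws := by
  obtain ⟨x, hx, -, ts, hts, -⟩ := hc v
  refine ⟨x, ts.map fun t => (termAt v t : T), by simp [hx], ?_⟩
  rw [hts]
  exact (values_iff hS v ts _).2 rfl

theorem step_iff (hS : SatOracle S) (hc : Computes c P) (K : Control (Fin s) (Fin l)) {v : T}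
    {x : NodeData L} {ws : List T} (hx : HasData S c v x ws) {σ : Fin s}
    {r r' : (T → Fin l) × (T → Bits n)} :
    Step K P (σ, v) r r' ↔ ∃ row ∈ x.2.2, row.1 = σ ∧ GoodRow n s ws.length x.1 row ∧
      Sat r (assign (K.src σ) v ws row.2.1) ∧ Sat r' (assign (K.tgt σ) v ws row.2.2) ∧
      ∀ y, y ∉ (assign (K.tgt σ) v ws row.2.2).map Prod.fst → stateVal r' y = stateVal r y := by
  obtain ⟨x', hx', hd⟩ := hc v
  obtain rfl : x = x' := by
    have h := hx.1
    rw [hx'] at h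
    exact Encodable.encode_injective (by simpa using h)
  obtain ⟨hcode, ts, hts, hsem⟩ := hd
  have hws : ws = ts.map fun t => (termAt v t : T) :=
    (values_iff hS v ts ws).1 (hts ▸ hx.2)
  have hread : ∀ μ : T → Bits n, readTerms v ts (fun w : nodeNbhd L v => μ w) =
      ws.map fun w => List.ofFn (μ w) := fun μ => by
    rw [hws, List.map_map]
    rfl
  have hvars : ∀ vals : List (List Bool), vals.length = ws.length → ∀ y,
      y ∈ (assign (K.tgt σ) v ws vals).map Prod.fst ↔ y = (v, false) ∨ y.2 = true ∧ y.1 ∈ ws := by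
    intro vals hlen y
    have h1 : (assign (K.tgt σ) v ws vals).map Prod.fst =
        (v, false) :: ((ws.zip vals).map Prod.fst).map fun w => (w, true) := by
      simp [assign]
    rw [h1, List.map_fst_zip (by omega), List.mem_cons, List.mem_map]
    obtain ⟨u, b⟩ := y
    constructor
    · rintro (h | ⟨w, hw, h⟩)
      · exact Or.inl h
      · obtain ⟨rfl, rfl⟩ := Prod.mk.inj h
        exact Or.inr ⟨rfl, hw⟩
    · rintro (h | ⟨h, hw⟩)
      · exact Or.inl h
      · exact Or.inr ⟨u, hw, by simpa using h.symm⟩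
  have hgsem : (r.2, r'.2) ∈ P.globalSem (σ, v) ↔
      ((σ : ℕ), (ws.map fun w => List.ofFn (r.2 w)), ws.map fun w => List.ofFn (r'.2 w)) ∈ x.2.2 ∧
        ∀ w, w ∉ ws → r.2 w = r'.2 w := by
    have h1 : (r.2, r'.2) ∈ P.globalSem (σ, v) ↔
        ((fun w : nodeNbhd L v => r.2 w), fun w : nodeNbhd L v => r'.2 w) ∈ P.sem σ v ∧
          ∀ w, w ∉ nodeNbhd L v → r.2 w = r'.2 w := Iff.rfl
    rw [h1, hsem, Set.mem_ofPred_eq, hread, hread]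
    constructor
    · rintro ⟨⟨h2, h3⟩, h4⟩
      refine ⟨h2, fun w hw => ?_⟩
      by_cases hN : w ∈ nodeNbhd L v
      · refine h3 ⟨w, hN⟩ fun t ht htw => hw ?_
        rw [hws]
        exact List.mem_map.2 ⟨t, ht, congrArg Subtype.val htw⟩
      · exact h4 w hN
    · rintro ⟨h2, h3⟩
      refine ⟨⟨h2, fun w hw => h3 w fun hmem => ?_⟩, fun w hw => h3 w fun hmem => ?_⟩
      · rw [hws] at hmem
        obtain ⟨t, ht, htw⟩ := List.mem_map.1 hmem
        exact hw t ht (Subtype.ext htw)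
      · rw [hws] at hmem
        obtain ⟨t, ht, htw⟩ := List.mem_map.1 hmem
        exact hw (htw ▸ (termAt v t).2)
  constructor
  · rintro ⟨⟨h1, h2, h3, h4⟩, h⟩
    obtain ⟨h5, h6⟩ := hgsem.1 h
    refine ⟨_, h5, rfl, ⟨σ.2, (hcode σ).1 h1, by simp, by simp, by simp, by simp⟩, ?_, ?_, ?_⟩
    · rw [sat_assign_iff (by simp)]
      exact ⟨congrArg Fin.val h2, rfl⟩
    · rw [sat_assign_iff (by simp)]
      exact ⟨congrArg Fin.val h3, rfl⟩
    · rintro ⟨u, b⟩ hy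
      rw [hvars _ (by simp)] at hy
      cases b with
      | false =>
        have : u ≠ v := fun h => hy (Or.inl (by rw [h]))
        simp [stateVal, h4 u this]
      | true =>
        have : u ∉ ws := fun h => hy (Or.inr ⟨rfl, h⟩)
        simp [stateVal, h6 u this]
  · rintro ⟨⟨σ', old, new⟩, h5, rfl, ⟨-, h1, hl1, hl2, -, -⟩, hR, hQ, hy⟩
    simp only at hl1 hl2 hR hQ hy h1
    rw [sat_assign_iff hl1] at hR
    rw [sat_assign_iff hl2] at hQ
    refine ⟨⟨(hcode σ).2 h1, Fin.ext hR.1, Fin.ext hQ.1, fun u hu => Fin.ext ?_⟩, hgsem.2 ⟨?_, ?_⟩⟩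
    · have := hy (u, false) (by rw [hvars _ hl2]; simpa using hu)
      simpa [stateVal] using this
    · rw [← hR.2, ← hQ.2]
      exact h5
    · intro w hw
      have := hy (w, true) (by rw [hvars _ hl2]; simpa using hw)
      simp only [stateVal, if_true] at this
      exact (List.ofFn_injective (Encodable.encode_injective this)).symm

theorem endpoints_mkInput (K : Control (Fin s) (Fin l)) (σ : Fin s) :
    endpoints (mkInput n K c) σ = ((K.src σ : ℕ), (K.tgt σ : ℕ)) := by
  simp [endpoints, mkInput]

end Data

end ParamTopo


namespace ParamTopo

open FirstOrder.Language
open scoped FirstOrder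

/-! ### Well-quasi-orders of partial states -/

theorem exists_finite_basis {α : Type*} {r : α → α → Prop} {W : Set α}
    (h : W.PartiallyWellOrderedOn r) : ∃ B : List α, (∀ b ∈ B, b ∈ W) ∧
      ∀ w ∈ W, ∃ b ∈ B, r b w := by
  classical
  by_contra hB
  push Not at hB
  have : Nonempty α := ⟨(hB [] (by simp)).choose⟩
  choose! w hw using hB
  let f : ℕ → {l : List α // ∀ b ∈ l, b ∈ W} := fun k =>
    Nat.rec ⟨[], by simp⟩ (fun _ l => ⟨w l.1 :: l.1, fun b hb => (List.mem_cons.1 hb).elim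
      (fun h => h ▸ (hw l.1 l.2).1) (l.2 b)⟩) k
  have hmono : ∀ i j, i < j → w (f i).1 ∈ (f j).1 := by
    intro i j hij
    induction j with
    | zero => omega
    | succ j ih =>
      rcases Nat.lt_succ_iff_lt_or_eq.1 hij with h | rfl
      · exact List.mem_cons_of_mem _ (ih h)
      · exact List.mem_cons_self
  obtain ⟨i, j, hij, hr⟩ := h fun k => ⟨w (f k).1, (hw _ (f k).2).1⟩
  exact (hw (f j).1 (f j).2).2 _ (hmono i j hij) hr

section WQO

variable {L : FirstOrder.Language} {T : Type*} [L.Structure T] {n l : ℕ}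

theorem MonadicWQO.partiallyWellOrderedOn (hwqo : MonadicWQO L T) (n l : ℕ) :
    {C : Cfg T | ∀ p ∈ C, ValidVal n l (p.1.2, p.2)}.PartiallyWellOrderedOn
      fun C D => ∃ π : T ≃[L] T, ∀ p ∈ moveCfg π C, p ∈ D := by
  let Q : Type := {y // ValidVal n l y}
  have : Finite Q := (finite_validVal n l).to_subtype
  have hfin : ∀ C : Cfg T, {a : Σ _ : Q, Fin 1 → T | ((a.2 0, a.1.1.1), a.1.1.2) ∈ C}.Finite := by
    intro C
    refine Set.Finite.of_finite_image (f := fun a => ((a.2 0, a.1.1.1), a.1.1.2))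
      (C.finite_toSet.subset ?_) ?_
    · rintro _ ⟨a, ha, rfl⟩
      exact ha
    · rintro ⟨⟨⟨b, k⟩, hq⟩, t⟩ - ⟨⟨⟨b', k'⟩, hq'⟩, t'⟩ - h
      simp only [Prod.mk.injEq] at h
      obtain ⟨⟨h1, rfl⟩, rfl⟩ := h
      have : t = t' := by
        funext i
        rw [Subsingleton.elim i 0, h1]
      rw [this]
  intro f
  obtain ⟨i, j, hij, π, hπ⟩ := hwqo Q (fun _ => 1) (fun _ => le_rfl) fun k => (hfin (f k).1).toFinset
  refine ⟨i, j, hij, π, ?_⟩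
  intro p hp
  obtain ⟨⟨⟨u, b⟩, k⟩, hq, rfl⟩ := List.mem_map.1 hp
  have := hπ ⟨⟨(b, k), (f i).2 _ hq⟩, fun _ => u⟩ (by simpa using hq)
  simpa using this

end WQO

/-! ### Certificates -/

section Certificates

variable {L : FirstOrder.Language} {T : Type*} [L.Structure T]

/-- The partial states `C` and `D` are isomorphic. -/
def Variant (S : List (Tok L (T ⊕ ℕ)) → Bool) (E : ℕ → List (List (Tok L ℕ)))
    (C D : Cfg T) : Prop :=
  C.map (fun p => (p.1.2, p.2)) = D.map (fun p => (p.1.2, p.2)) ∧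
    SameClass S E (C.map fun p => p.1.1) (D.map fun p => p.1.1)

theorem variant_iff {S : List (Tok L (T ⊕ ℕ)) → Bool} (hS : SatOracle S)
    {E : ℕ → List (List (Tok L ℕ))} (hE : ClassOracle L T E) (hhom : L.IsUltrahomogeneous T)
    {C D : Cfg T} (hC : C ≠ []) : Variant S E C D ↔ ∃ π : T ≃[L] T, D = moveCfg π C := by
  rw [Variant, sameClass_iff hS hE hhom _ _ (by simpa using hC)]
  constructor
  · rintro ⟨h1, π, h2⟩
    refine ⟨π, ?_⟩
    clear hC
    induction C generalizing D with
    | nil =>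
      obtain rfl : D = [] := by simpa using h1.symm
      rfl
    | cons p C ih =>
      cases D with
      | nil => simp at h1
      | cons q D =>
        obtain ⟨⟨u, b⟩, k⟩ := p
        obtain ⟨⟨u', b'⟩, k'⟩ := q
        simp only [List.map_cons, List.cons.injEq, Prod.mk.injEq] at h1 h2
        obtain ⟨⟨rfl, rfl⟩, h1⟩ := h1
        obtain ⟨rfl, h2⟩ := h2
        rw [ih h1 h2]
        rfl
  · rintro ⟨π, rfl⟩
    exact ⟨by simp [moveCfg, Function.comp_def], π, by simp [moveCfg, Function.comp_def]⟩

/-- The assignment `p` holds in the initial state. -/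
def InitVal (i : Input) (p : (T × Bool) × ℕ) : Prop :=
  (p.1.2 = false ∧ p.2 = i.2.1.1) ∨
    (p.1.2 = true ∧ p.2 = Encodable.encode (List.replicate i.1.1 false))

/-- The negation of `InitVal`, in positive form. -/
def NonInitVal (i : Input) (p : (T × Bool) × ℕ) : Prop :=
  (p.1.2 = false ∧ p.2 ≠ i.2.1.1) ∨
    (p.1.2 = true ∧ p.2 ≠ Encodable.encode (List.replicate i.1.1 false))

theorem nonInitVal_iff (i : Input) (p : (T × Bool) × ℕ) : NonInitVal i p ↔ ¬ InitVal i p := by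
  obtain ⟨⟨u, b⟩, k⟩ := p
  cases b <;> simp [NonInitVal, InitVal]

/-- The partial state that is read by a row at `v`. -/
def readCfg (i : Input) (v : T) (ws : List T) (row : Row) : Cfg T :=
  assign (endpoints i row.1).1 v ws row.2.1

/-- The partial state that is written by a row at `v`. -/
def writeCfg (i : Input) (v : T) (ws : List T) (row : Row) : Cfg T :=
  assign (endpoints i row.1).2 v ws row.2.2

theorem sat_init_iff {n s l : ℕ} (c : Nat.Partrec.Code) (K : Control (Fin s) (Fin l))
    {C : Cfg T} :
    Sat (n := n) ((fun _ => K.init), fun _ _ => false) C ↔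
      ∀ p ∈ C, InitVal (mkInput n K c) p := by
  refine forall₂_congr fun p _ => ?_
  obtain ⟨⟨u, b⟩, k⟩ := p
  cases b <;> simp [stateVal, InitVal, mkInput, eq_comm, List.ofFn_const]

theorem sat_error_iff {n s l : ℕ} (c : Nat.Partrec.Code) (K : Control (Fin s) (Fin l))
    {r : (T → Fin l) × (T → Bits n)} {u : T} :
    Sat r [((u, false), (mkInput n K c).2.1.2)] ↔ r.1 u = K.err := by
  simp [Sat, stateVal, mkInput, Fin.ext_iff]

variable [Primcodable T] [Primcodable (FunSym L)]
  (S : List (Tok L (T ⊕ ℕ)) → Bool) (E : ℕ → List (List (Tok L ℕ))) (reps : List T)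

/-- A backward step from `C` to a partial state `D`. -/
def BackStep (i : Input) (C D : Cfg T) : Prop :=
  ∃ v x ws, HasData S i.2.2.2 v x ws ∧ ∃ row ∈ x.2.2,
    GoodRow i.1.1 i.1.2.1 ws.length x.1 row ∧ Consistent (writeCfg i v ws row ++ C) ∧
      IsPre (readCfg i v ws row) (writeCfg i v ws row) C D

/-- A backward run from an error state to an initial state exists. -/
def UnsafeCert (i : Input) : Prop :=
  ∃ u C, Relation.ReflTransGen (BackStep S i) [((u, false), i.2.1.2)] C ∧ ∀ p ∈ C, InitVal i p

/-- The list `B` generates a set of states that is closed under predecessors at the node `v` of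
states that extend `C`. -/
def ClosedAt (i : Input) (B : List (Cfg T)) (C : Cfg T) (v : T) : Prop :=
  ∃ x ws, HasData S i.2.2.2 v x ws ∧ ∀ row ∈ x.2.2,
    ¬ GoodRow i.1.1 i.1.2.1 ws.length x.1 row ∨ ¬ Consistent (writeCfg i v ws row ++ C) ∨
      ∃ D ∈ B, ∃ D', Variant S E D D' ∧
        BelowPre (readCfg i v ws row) (writeCfg i v ws row) C D'

/-- The finite list `B` generates a set of states that contains all error states, is closed under
predecessors, and contains no initial state. -/
def SafeCert (i : Input) : Prop :=
  ∃ B : List (Cfg T), (∀ r ∈ reps, [((r, false), i.2.1.2)] ∈ B) ∧ ∀ C ∈ B,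
    (∃ p ∈ C, NonInitVal i p) ∧ ∃ vs, CoversNodes S E (C.map fun p => p.1.1) vs ∧
      ∀ v ∈ vs, ClosedAt S E i B C v

variable {S E reps} (hS : SatOracle S) {n s l : ℕ} {c : Nat.Partrec.Code}
  {P : Program L T (Fin s) (Bits n)} (hc : Computes c P) (K : Control (Fin s) (Fin l))

include hS hc

theorem unsafeCert_iff :
    UnsafeCert S (mkInput n K c) ↔ ¬ P.SafeFrom K {fun _ _ => false} := by
  rw [not_safeFrom_iff_reflTransGen]
  constructor
  · rintro ⟨u, C, hC, hinit⟩
    suffices ∀ r, Sat r C → ∃ r', Relation.ReflTransGen (fun s s' => ∃ e, Step K P e s s') r r' ∧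
        r'.1 u = K.err by
      obtain ⟨r', h1, h2⟩ := this _ ((sat_init_iff c K).2 hinit)
      exact ⟨r', u, h1, h2⟩
    clear hinit
    induction hC with
    | refl => exact fun r hr => ⟨r, .refl, (sat_error_iff c K).1 hr⟩
    | tail _ hstep ih =>
      intro r hr
      obtain ⟨v, x, ws, hx, row, hrow, hgood, hcons, hpre⟩ := hstep
      have hlt : row.1 < s := hgood.1
      have hend := endpoints_mkInput (n := n) (c := c) K ⟨row.1, hlt⟩
      simp only at hend
      simp only [readCfg, writeCfg, hend] at hcons hpre
      obtain ⟨h1, r', h2, h3, h4⟩ := hpre.exists_sat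
        (hgood.validVal (K.tgt ⟨row.1, hlt⟩).2 v ws (Or.inr rfl)) hcons hr
      have hst : Step K P (⟨row.1, hlt⟩, v) r r' :=
        (step_iff hS hc K hx).2 ⟨row, hrow, rfl, hgood, h1, h2, h4⟩
      obtain ⟨r'', h5, h6⟩ := ih r' h3
      exact ⟨r'', h5.head ⟨_, hst⟩, h6⟩
  · rintro ⟨r, u, hr, hu⟩
    suffices ∀ r₀, Relation.ReflTransGen (fun s s' => ∃ e, Step K P e s s') r₀ r →
        ∃ C, Relation.ReflTransGen (BackStep S (mkInput n K c))
          [((u, false), (mkInput n K c).2.1.2)] C ∧ Sat r₀ C by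
      obtain ⟨C, h1, h2⟩ := this _ hr
      exact ⟨u, C, h1, (sat_init_iff c K).1 h2⟩
    clear hr
    intro r₀ hr
    induction hr using Relation.ReflTransGen.head_induction_on with
    | refl => exact ⟨_, .refl, (sat_error_iff c K).2 hu⟩
    | head hst _ ih =>
      obtain ⟨⟨σ, v⟩, hst⟩ := hst
      obtain ⟨C, h1, h2⟩ := ih
      obtain ⟨x, ws, hx⟩ := exists_hasData hS hc v
      obtain ⟨row, hrow, hσ, hgood, h3, h4, h5⟩ := (step_iff hS hc K hx).1 hst
      obtain ⟨D, hD, hD'⟩ := exists_pre (readCfg (mkInput n K c) v ws row)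
        (writeCfg (mkInput n K c) v ws row) C
      have hend := endpoints_mkInput (n := n) (c := c) K σ
      rw [← hσ] at hend
      refine ⟨D, h1.tail ⟨v, x, ws, hx, row, hrow, hgood, ?_, hD⟩, ?_⟩
      · simp only [writeCfg, hend]
        exact (h4.append h2).consistent
      · refine hD'.sat (s' := _) ?_ h2 ?_
        · simpa only [readCfg, hend] using h3
        · simpa only [writeCfg, hend] using h5

theorem SafeCert.safeFrom (hE : ClassOracle L T E) (hhom : L.IsUltrahomogeneous T)
    (hreps : CoversNodes S E [] reps) (hP : LocCompat P P)
    (h : SafeCert S E reps (mkInput n K c)) : P.SafeFrom K {fun _ _ => false} := by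
  obtain ⟨B, herr, hB⟩ := h
  by_contra hreach
  rw [not_safeFrom_iff_reflTransGen] at hreach
  obtain ⟨r, u, hr, hu⟩ := hreach
  suffices ∀ r₀, Relation.ReflTransGen (fun s s' => ∃ e, Step K P e s s') r₀ r →
      ∃ C ∈ B, ∃ π : T ≃[L] T, Sat r₀ (moveCfg π C) by
    obtain ⟨C, hC, π, hsat⟩ := this _ hr
    obtain ⟨⟨p, hp, hinit⟩, -⟩ := hB C hC
    rw [nonInitVal_iff] at hinit
    refine hinit ((sat_init_iff (n := n) c K (C := C)).1 ?_ p hp)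
    have := hsat.move (f := π.symm) (g := π) (by simp)
    have h2 : moveCfg π.symm (moveCfg π C) = C := by
      simp [moveCfg, Function.comp_def]
    rw [h2] at this
    exact this
  clear hr
  intro r₀ hr
  induction hr using Relation.ReflTransGen.head_induction_on with
  | refl =>
    obtain ⟨v, hv, π, -, rfl⟩ := hreps.exists_equiv hS hE hhom u
    refine ⟨_, herr _ hv, π.symm, ?_⟩
    rw [← sat_error_iff c K] at hu
    simpa [moveCfg] using hu
  | @head r r' hst _ ih =>
    obtain ⟨⟨σ, v⟩, hst⟩ := hst
    obtain ⟨C, hC, π, hsat⟩ := ih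
    obtain ⟨-, vs, hvs, hclosed⟩ := hB C hC
    obtain ⟨v', hv', τ, hτ, hτv⟩ := hvs.exists_equiv hS hE hhom (π.symm v)
    obtain ⟨x, ws, hx, hrows⟩ := hclosed v' hv'
    have hst' := hst.map_equiv hP (τ.comp π.symm)
    have hv : (τ.comp π.symm) v = v' := by simpa using hτv
    rw [hv] at hst'
    obtain ⟨row, hrow, hσ, hgood, h3, h4, h5⟩ := (step_iff hS hc K hx).1 hst'
    have hsat' : Sat (r'.1 ∘ (τ.comp π.symm).symm, r'.2 ∘ (τ.comp π.symm).symm) C := by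
      have := hsat.move (f := τ.comp π.symm) (g := (τ.comp π.symm).symm) (by simp)
      have h2 : moveCfg (τ.comp π.symm) (moveCfg π C) = C := by
        simp only [moveCfg, List.map_map]
        conv_rhs => rw [← List.map_id C]
        refine List.map_congr_left fun p hp => ?_
        have := hτ p.1.1 (List.mem_map.2 ⟨p, hp, rfl⟩)
        simp [this]
      rwa [h2] at this
    have hend := endpoints_mkInput (n := n) (c := c) K σ
    rw [← hσ] at hend
    have hrow' := hrows row hrow
    simp only [readCfg, writeCfg, hend] at hrow'
    rcases hrow' with h | h | ⟨D, hD, D', hvar, hbelow⟩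
    · exact absurd hgood h
    · exact absurd (h4.append hsat').consistent h
    · have hD0 : D ≠ [] := by
        rintro rfl
        obtain ⟨⟨p, hp, -⟩, -⟩ := hB _ hD
        simp at hp
      obtain ⟨ρ, rfl⟩ := (variant_iff hS hE hhom hD0).1 hvar
      have h6 := (hbelow.sat h3 hsat' h5).move (f := (τ.comp π.symm).symm) (g := τ.comp π.symm)
        (by simp)
      refine ⟨D, hD, (τ.comp π.symm).symm.comp ρ, ?_⟩
      have h7 : moveCfg (τ.comp π.symm).symm (moveCfg ρ D) =
          moveCfg ((τ.comp π.symm).symm.comp ρ) D := by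
        simp [moveCfg, Function.comp_def]
      rw [h7] at h6
      convert h6 using 1
      refine Prod.ext ?_ ?_ <;> funext y <;> simp

theorem safeCert_of_safeFrom (hE : ClassOracle L T E) (hhom : L.IsUltrahomogeneous T)
    (hwqo : MonadicWQO L T) (reps : List T)
    (hsafe : P.SafeFrom K {fun _ _ => false}) : SafeCert S E reps (mkInput n K c) := by
  have hnot : ¬ UnsafeCert S (mkInput n K c) := fun h => (unsafeCert_iff hS hc K).1 h hsafe
  let W : Set (Cfg T) := {C | (C ≠ [] ∧ ∀ p ∈ C, ValidVal n l (p.1.2, p.2)) ∧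
    ∃ u, Relation.ReflTransGen (BackStep S (mkInput n K c))
      [((u, false), (mkInput n K c).2.1.2)] C}
  have hW : W.PartiallyWellOrderedOn fun C D => ∃ π : T ≃[L] T, ∀ p ∈ moveCfg π C, p ∈ D :=
    (hwqo.partiallyWellOrderedOn n l).mono fun C hC => hC.1.2
  obtain ⟨B, hBW, hB⟩ := exists_finite_basis hW
  let B' := (reps.map fun r => [((r, false), (mkInput n K c).2.1.2)]) ++ B
  have hB'W : ∀ C ∈ B', C ∈ W := by
    intro C hC
    rcases List.mem_append.1 hC with h | h
    · obtain ⟨r, -, rfl⟩ := List.mem_map.1 h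
      exact ⟨⟨by simp, by simp [ValidVal, mkInput]⟩, r, .refl⟩
    · exact hBW C h
  refine ⟨B', fun r hr => List.mem_append_left _ (List.mem_map.2 ⟨r, hr, rfl⟩), fun C hC => ?_⟩
  obtain ⟨⟨hC0, hCv⟩, u, hu⟩ := hB'W C hC
  constructor
  · by_contra hinit
    push Not at hinit
    refine hnot ⟨u, C, hu, fun p hp => ?_⟩
    have := hinit p hp
    rwa [nonInitVal_iff, not_not] at this
  · obtain ⟨vs, hvs⟩ := exists_coversNodes hS hE (C.map fun p => p.1.1)
    refine ⟨vs, hvs, fun v _ => ?_⟩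
    obtain ⟨x, ws, hx⟩ := exists_hasData hS hc v
    refine ⟨x, ws, hx, fun row hrow => ?_⟩
    by_cases hgood : GoodRow n s ws.length x.1 row
    · by_cases hcons : Consistent (writeCfg (mkInput n K c) v ws row ++ C)
      · refine Or.inr (Or.inr ?_)
        obtain ⟨D, hD, hD'⟩ := exists_pre (readCfg (mkInput n K c) v ws row)
          (writeCfg (mkInput n K c) v ws row) C
        have hDW : D ∈ W := by
          refine ⟨⟨?_, ?_⟩, u, hu.tail ⟨v, x, ws, hx, row, hrow, hgood, hcons, hD⟩⟩
          · exact List.ne_nil_of_mem (hD.1 _ List.mem_cons_self)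
          · intro p hp
            rcases hD' p hp with h | ⟨h, -⟩
            · have hend := endpoints_mkInput (n := n) (c := c) K ⟨row.1, hgood.1⟩
              simp only at hend
              simp only [readCfg, hend] at h
              exact hgood.validVal (K.src ⟨row.1, hgood.1⟩).2 v ws (Or.inl rfl) p h
            · exact hCv p h
        obtain ⟨D₀, hD₀, π, hπ⟩ := hB D hDW
        refine ⟨D₀, List.mem_append_right _ hD₀, moveCfg π D₀,
          (variant_iff hS hE hhom (hBW _ hD₀).1.1).2 ⟨π, rfl⟩, fun p hp => hD' p (hπ p hp)⟩
      · exact Or.inr (Or.inl hcons)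
    · exact Or.inl hgood

end Certificates

end ParamTopo


/-! ### Computable operations on lists and words -/

section Lists

variable {α β γ δ ε : Type*} [Primcodable α] [Primcodable β] [Primcodable γ] [Primcodable δ]
  [Primcodable ε]

theorem Primrec.sumMap {f : α → β ⊕ γ} {g : α → β → δ} {h : α → γ → ε} (hf : Primrec f)
    (hg : Primrec₂ g) (hh : Primrec₂ h) : Primrec fun a => Sum.map (g a) (h a) (f a) :=
  (Primrec.sumCasesOn hf (Primrec.sumInl.comp₂ hg) (Primrec.sumInr.comp₂ hh)).of_eq fun a => by
    cases f a <;> rfl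

theorem Primrec.list_zip : Primrec₂ (List.zip : List α → List β → List (α × β)) := by
  have h : Primrec fun x : List α × List β => (List.range x.1.length).filterMap fun i =>
      (x.1[i]?).bind fun a => (x.2[i]?).map fun b => (a, b) := by
    refine Primrec.listFilterMap (Primrec.list_range.comp (Primrec.list_length.comp Primrec.fst)) ?_
    refine Primrec.option_bind (Primrec.list_getElem?.comp (Primrec.fst.comp Primrec.fst)
      Primrec.snd) ?_
    refine Primrec.option_map (Primrec.list_getElem?.comp
      (Primrec.snd.comp (Primrec.fst.comp Primrec.fst)) (Primrec.snd.comp Primrec.fst)) ?_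
    exact (Primrec.snd.comp Primrec.fst).pair Primrec.snd
  refine h.of_eq fun x => ?_
  obtain ⟨l, m⟩ := x
  simp only
  induction l generalizing m with
  | nil => rfl
  | cons a l ih =>
    cases m with
    | nil => simp
    | cons b m =>
      rw [List.length_cons, List.range_succ_eq_map, List.filterMap_cons, List.filterMap_map]
      simpa [Function.comp_def] using ih m

@[fun_prop]
theorem Computable.zip_comp {f : α → List β} {g : α → List γ} (hf : Computable f)
    (hg : Computable g) : Computable fun a => (f a).zip (g a) :=
  Primrec.list_zip.to_comp.comp hf hg

@[fun_prop]
theorem Computable.map_comp {f : α → List β} {g : β → γ} (hf : Computable f)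
    (hg : Primrec g) : Computable fun a => (f a).map g :=
  (Primrec.list_map Primrec.id (hg.comp Primrec.snd).to₂).to_comp.comp hf

@[fun_prop]
theorem Primrec.encode_comp {f : α → β} (hf : Primrec f) :
    Primrec fun a => Encodable.encode (f a) :=
  Primrec.encode.comp hf

@[fun_prop]
theorem Computable.encode_comp {f : α → β} (hf : Computable f) :
    Computable fun a => Encodable.encode (f a) :=
  Computable.encode.comp hf

@[fun_prop]
theorem Computable.replicate_comp {f : α → ℕ} (hf : Computable f) (b : β) :
    Computable fun a => List.replicate (f a) b := by
  have h : Primrec fun n : ℕ => (List.range n).map fun _ => b :=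
    Primrec.list_map Primrec.list_range (Primrec.const b).to₂
  have h' : Primrec fun n : ℕ => List.replicate n b := h.of_eq fun n => by simp [List.map_const']
  exact h'.to_comp.comp hf

end Lists

namespace ParamTopo

open FirstOrder.Language
open scoped FirstOrder

section Words

variable {L : FirstOrder.Language} {T α : Type*} [Primcodable T] [Primcodable α]
  [Primcodable (FunSym L)] [Primcodable (RelSym L)]

@[fun_prop]
theorem computable_assign {k : α → ℕ} {v : α → T} {ws : α → List T}
    {vals : α → List (List Bool)} (hk : Computable k) (hv : Computable v) (hws : Computable ws)
    (hvals : Computable vals) : Computable fun a => assign (k a) (v a) (ws a) (vals a) := by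
  unfold assign
  fun_prop

@[fun_prop]
theorem computable_endpoints {i : α → Input} {σ : α → ℕ} (hi : Computable i)
    (hσ : Computable σ) : Computable fun a => endpoints (i a) (σ a) :=
  Computable.option_getD
    (Computable.list_getElem?.comp (by fun_prop : Computable fun a => (i a).2.2.1) hσ)
    (Computable.const (0, 0))

@[fun_prop]
theorem computable_readCfg {i : α → Input} {v : α → T} {ws : α → List T} {row : α → Row}
    (hi : Computable i) (hv : Computable v) (hws : Computable ws) (hrow : Computable row) :
    Computable fun a => readCfg (i a) (v a) (ws a) (row a) := by
  unfold readCfg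
  fun_prop

@[fun_prop]
theorem computable_writeCfg {i : α → Input} {v : α → T} {ws : α → List T} {row : α → Row}
    (hi : Computable i) (hv : Computable v) (hws : Computable ws) (hrow : Computable row) :
    Computable fun a => writeCfg (i a) (v a) (ws a) (row a) := by
  unfold writeCfg
  fun_prop

theorem primrec_renameTok : Primrec₂ fun (a : List T) (t : Tok L ℕ) =>
    renameTok (lookupVar a) t := by
  have h : Primrec₂ fun (a : List T) (i : ℕ) => lookupVar a i := by
    refine (Primrec.option_casesOn (o := fun x : List T × ℕ => x.1[x.2]?)
      (f := fun x => (Sum.inr x.2 : T ⊕ ℕ)) (g := fun _ t => Sum.inl t)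
      (Primrec.list_getElem?.comp Primrec.fst Primrec.snd) (Primrec.sumInr.comp Primrec.snd)
      (Primrec.sumInl.comp Primrec.snd)).of_eq fun x => ?_
    simp only [lookupVar]
    cases x.1[x.2]? <;> rfl
  refine Primrec.sumMap Primrec.snd ?_ (Primrec.snd)
  refine Primrec.sumMap Primrec.snd ?_ (Primrec.snd)
  refine Primrec.sumMap Primrec.snd ?_ (Primrec.snd)
  exact h.comp (Primrec.fst.comp (Primrec.fst.comp (Primrec.fst.comp Primrec.fst))) Primrec.snd

theorem primrec_substWord : Primrec₂ (substWord (L := L) (T := T)) :=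
  Primrec.list_map Primrec.snd
    (primrec_renameTok.comp (Primrec.fst.comp Primrec.fst) Primrec.snd)

@[fun_prop]
theorem computable_substWord {a : α → List T} {w : α → List (Tok L ℕ)} (ha : Computable a)
    (hw : Computable w) : Computable fun x => substWord (L := L) (a x) (w x) :=
  Computable₂.comp (Primrec₂.to_comp primrec_substWord) ha hw

theorem primrec_eqWord_tail : Primrec₂ fun (v : T) (t : List (Unit ⊕ FunSym L)) =>
    t.map fun x => (Sum.inl (x.map (fun _ => Sum.inl (Sum.inl v)) id) : Tok L (T ⊕ ℕ)) := by
  refine Primrec.list_map Primrec.snd (Primrec.sumInl.comp ?_)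
  refine Primrec.sumMap Primrec.snd ?_ Primrec.snd
  exact Primrec.sumInl.comp (Primrec.sumInl.comp (Primrec.fst.comp (Primrec.fst.comp Primrec.fst)))

@[fun_prop]
theorem computable_eqWord {w v : α → T} {t : α → List (Unit ⊕ FunSym L)} (hw : Computable w)
    (hv : Computable v) (ht : Computable t) :
    Computable fun x => eqWord (L := L) (w x) (v x) (t x) := by
  have h1 := Computable₂.comp (Primrec₂.to_comp (primrec_eqWord_tail (L := L))) hv ht
  have h2 : Computable fun x => (Sum.inl (Sum.inl (Sum.inl (Sum.inl (w x)))) : Tok L (T ⊕ ℕ)) :=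
    Computable.sumInl.comp (Computable.sumInl.comp (Computable.sumInl.comp
      (Computable.sumInl.comp hw)))
  exact (Computable.const _).cons_comp (h2.cons_comp h1)

end Words

/-! ### Certificates are recursively enumerable -/

section Enumerable

variable {L : FirstOrder.Language} {T α : Type*} [Primcodable T] [Primcodable α]
  [Primcodable (FunSym L)]

theorem rePred_mem_eval {c : α → Nat.Partrec.Code} {m k : α → ℕ} (hc : Computable c)
    (hm : Computable m) (hk : Computable k) : REPred fun a => m a ∈ (c a).eval (k a) := by
  have h : REPred fun x : (Nat.Partrec.Code × ℕ × ℕ) × ℕ =>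
      Nat.Partrec.Code.evaln x.2 x.1.1 x.1.2.2 = some x.1.2.1 :=
    REPred.eq (Nat.Partrec.Code.primrec_evaln.to_comp.comp
      (by fun_prop : Computable fun x : (Nat.Partrec.Code × ℕ × ℕ) × ℕ =>
        ((x.2, x.1.1), x.1.2.2)))
      (Computable.option_some.comp (by fun_prop))
  exact (h.exists_of.comp (hc.pair (hm.pair hk))).of_eq fun a =>
    Nat.Partrec.Code.evaln_complete.symm

theorem rePred_consistent {C : α → Cfg T} (hC : Computable C) :
    REPred fun a => Consistent (C a) := by
  refine REPred.forall_mem hC (REPred.forall_mem (by fun_prop) ?_)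
  refine ((REPred.ne ?_ ?_).or (REPred.eq ?_ ?_)).of_eq (fun x => (imp_iff_not_or).symm) <;>
    fun_prop

theorem rePred_not_consistent {C : α → Cfg T} (hC : Computable C) :
    REPred fun a => ¬ Consistent (C a) := by
  have h : REPred fun a => ∃ p ∈ C a, ∃ q ∈ C a, p.1 = q.1 ∧ p.2 ≠ q.2 := by
    refine REPred.exists_mem hC (REPred.exists_mem (by fun_prop) ?_)
    exact (REPred.eq (by fun_prop) (by fun_prop)).and (REPred.ne (by fun_prop) (by fun_prop))
  exact h.of_eq fun a => by simp only [Consistent]; push Not; rfl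

theorem rePred_goodRow {n s m : α → ℕ} {cmds : α → List ℕ} {row : α → Row} (hn : Computable n)
    (hs : Computable s) (hm : Computable m) (hcmds : Computable cmds) (hrow : Computable row) :
    REPred fun a => GoodRow (n a) (s a) (m a) (cmds a) (row a) := by
  have hlen : ∀ {vals : α → List (List Bool)}, Computable vals →
      REPred fun a => ∀ b ∈ vals a, b.length = n a := fun hvals => by
    refine REPred.forall_mem hvals ?_
    exact REPred.eq (by fun_prop) (by fun_prop)
  refine (REPred.lt ?_ ?_).and ((REPred.mem ?_ ?_).and ((REPred.eq ?_ ?_).and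
    ((REPred.eq ?_ ?_).and ((hlen ?_).and (hlen ?_))))) <;> fun_prop

theorem rePred_not_goodRow {n s m : α → ℕ} {cmds : α → List ℕ} {row : α → Row}
    (hn : Computable n) (hs : Computable s) (hm : Computable m) (hcmds : Computable cmds)
    (hrow : Computable row) :
    REPred fun a => ¬ GoodRow (n a) (s a) (m a) (cmds a) (row a) := by
  have h : REPred fun a => s a < (row a).1 + 1 ∨ (∀ k ∈ cmds a, (row a).1 ≠ k) ∨
      (row a).2.1.length ≠ m a ∨ (row a).2.2.length ≠ m a ∨
      (∃ b ∈ (row a).2.1, b.length ≠ n a) ∨ ∃ b ∈ (row a).2.2, b.length ≠ n a := by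
    have hlen : ∀ {vals : α → List (List Bool)}, Computable vals →
        REPred fun a => ∃ b ∈ vals a, b.length ≠ n a := fun hvals => by
      refine REPred.exists_mem hvals ?_
      exact REPred.ne (by fun_prop) (by fun_prop)
    have hmem : REPred fun a => ∀ k ∈ cmds a, (row a).1 ≠ k := by
      refine REPred.forall_mem hcmds ?_
      exact REPred.ne (by fun_prop) (by fun_prop)
    refine (REPred.lt ?_ ?_).or (hmem.or ((REPred.ne ?_ ?_).or ((REPred.ne ?_ ?_).or
      ((hlen ?_).or (hlen ?_))))) <;> fun_prop
  refine h.of_eq fun a => ?_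
  have hmem : (∀ k ∈ cmds a, (row a).1 ≠ k) ↔ (row a).1 ∉ cmds a :=
    ⟨fun h hk => h _ hk rfl, fun h k hk hr => h (hr ▸ hk)⟩
  rw [hmem]
  simp only [GoodRow, not_and_or, not_lt, Nat.lt_succ_iff]
  push Not
  rfl

theorem rePred_isPre {R Q C D : α → Cfg T} (hR : Computable R) (hQ : Computable Q)
    (hC : Computable C) (hD : Computable D) :
    REPred fun a => IsPre (R a) (Q a) (C a) (D a) := by
  refine (REPred.forall_mem hR ?_).and (REPred.forall_mem hC ?_)
  · exact REPred.mem (by fun_prop) (by fun_prop)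
  · refine (REPred.mem (by fun_prop) (by fun_prop)).or (REPred.exists_mem (by fun_prop) ?_)
    exact REPred.eq (by fun_prop) (by fun_prop)

theorem rePred_belowPre {R Q C D : α → Cfg T} (hR : Computable R) (hQ : Computable Q)
    (hC : Computable C) (hD : Computable D) :
    REPred fun a => BelowPre (R a) (Q a) (C a) (D a) := by
  refine REPred.forall_mem ?_ ((REPred.mem ?_ ?_).or ((REPred.mem ?_ ?_).and
    (REPred.forall_mem ?_ (REPred.ne ?_ ?_)))) <;> fun_prop

theorem rePred_initVal {i : α → Input} {p : α → (T × Bool) × ℕ} (hi : Computable i)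
    (hp : Computable p) : REPred fun a => InitVal (i a) (p a) := by
  refine ((REPred.eq ?_ ?_).and (REPred.eq ?_ ?_)).or ((REPred.eq ?_ ?_).and (REPred.eq ?_ ?_)) <;>
    fun_prop

theorem rePred_nonInitVal {i : α → Input} {p : α → (T × Bool) × ℕ} (hi : Computable i)
    (hp : Computable p) : REPred fun a => NonInitVal (i a) (p a) := by
  refine ((REPred.eq ?_ ?_).and (REPred.ne ?_ ?_)).or ((REPred.eq ?_ ?_).and (REPred.ne ?_ ?_)) <;>
    fun_prop

variable [Primcodable (RelSym L)] {S : List (Tok L (T ⊕ ℕ)) → Bool} (hS : Computable S)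
  {E : ℕ → List (List (Tok L ℕ))} (hE : Computable E)

include hS

theorem rePred_hasData {c : α → Nat.Partrec.Code} {v : α → T} {x : α → NodeData L}
    {ws : α → List T} (hc : Computable c) (hv : Computable v) (hx : Computable x)
    (hws : Computable ws) : REPred fun a => HasData S (c a) (v a) (x a) (ws a) := by
  refine (rePred_mem_eval ?_ ?_ ?_).and ((REPred.eq ?_ ?_).and
    (REPred.forall_mem ?_ (REPred.of_bool ?_ true))) <;> fun_prop

theorem rePred_unsafeCert : REPred (UnsafeCert (T := T) S) := by
  have hstep : REPred fun x : Input × Cfg T × Cfg T => BackStep S x.1 x.2.1 x.2.2 := by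
    refine REPred.exists_right (REPred.exists_right (REPred.exists_right ?_))
    refine (rePred_hasData hS ?_ ?_ ?_ ?_).and (REPred.exists_mem ?_
      ((rePred_goodRow ?_ ?_ ?_ ?_ ?_).and ((rePred_consistent ?_).and
        (rePred_isPre ?_ ?_ ?_ ?_)))) <;> fun_prop
  refine REPred.exists_right (REPred.exists_right ((REPred.reflTransGen hstep ?_ ?_ ?_).and
    (REPred.forall_mem ?_ (rePred_initVal ?_ ?_)))) <;> fun_prop

include hE

theorem rePred_sameClass {a b : α → List T} (ha : Computable a) (hb : Computable b) :
    REPred fun x => SameClass S E (a x) (b x) := by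
  refine (REPred.eq ?_ ?_).and ((REPred.lt ?_ ?_).and (REPred.exists_mem ?_
    ((REPred.of_bool ?_ true).and (REPred.of_bool ?_ true)))) <;> fun_prop

theorem rePred_coversNodes {a b : α → List T} (ha : Computable a) (hb : Computable b) :
    REPred fun x => CoversNodes S E (a x) (b x) := by
  refine REPred.forall_mem ?_ ((REPred.of_bool ?_ false).or
    (REPred.exists_mem ?_ (REPred.of_bool ?_ true))) <;> fun_prop

theorem rePred_closedAt {i : α → Input} {B : α → List (Cfg T)} {C : α → Cfg T} {v : α → T}
    (hi : Computable i) (hB : Computable B) (hC : Computable C) (hv : Computable v) :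
    REPred fun a => ClosedAt S E (i a) (B a) (C a) (v a) := by
  refine REPred.exists_right (REPred.exists_right ((rePred_hasData hS ?_ ?_ ?_ ?_).and
    (REPred.forall_mem ?_ ((rePred_not_goodRow ?_ ?_ ?_ ?_ ?_).or
      ((rePred_not_consistent ?_).or (REPred.exists_mem ?_ (REPred.exists_right
        (((REPred.eq ?_ ?_).and (rePred_sameClass hS hE ?_ ?_)).and
          (rePred_belowPre ?_ ?_ ?_ ?_))))))))) <;> fun_prop

theorem rePred_safeCert (reps : List T) : REPred (SafeCert S E reps) := by
  refine REPred.exists_right (REPred.and (REPred.forall_mem (by fun_prop) ?_)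
    (REPred.forall_mem (by fun_prop) (REPred.and (REPred.exists_mem (by fun_prop) ?_)
      (REPred.exists_right (REPred.and ?_ (REPred.forall_mem (by fun_prop) ?_))))))
  · exact REPred.mem (by fun_prop) (by fun_prop)
  · exact rePred_nonInitVal (by fun_prop) (by fun_prop)
  · exact rePred_coversNodes hS hE (by fun_prop) (by fun_prop)
  · exact rePred_closedAt hS hE (by fun_prop) (by fun_prop) (by fun_prop) (by fun_prop)

end Enumerable

end ParamTopo

open ParamTopo
theorem corollary6p11 (L : FirstOrder.Language) (T : Type*) [L.Structure T]
    [Primcodable T] [Primcodable (FunSym L)] [Primcodable (RelSym L)]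
    (heff : Effective L T)
    (hhom : L.IsUltrahomogeneous T)
    (hclasses : ComputableClasses L T)
    (hsat : DecidableSat L T)
    (hwqo : MonadicWQO L T) :
    ∃ decide : Input →. Bool, Partrec decide ∧
      ∀ (n s l : ℕ) (K : Control (Fin s) (Fin l)) (𝓟 : ParamProgram L (Fin s) (Bits n)),
        𝓟.IsBoolean → IsLimit T 𝓟 →
        ∀ c : Nat.Partrec.Code, Computes c (limitProgram T 𝓟) →
          ∃ b ∈ decide (mkInput n K c), (b = true ↔ 𝓟.Safe K) := by
  obtain ⟨S, hSc, hS⟩ := hsat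
  obtain ⟨E, hEc, hE⟩ := hclasses
  change SatOracle S at hS
  change ClassOracle L T E at hE
  obtain ⟨reps, hreps⟩ := exists_coversNodes hS hE []
  obtain ⟨d, hd, hdec⟩ :=
    (rePred_safeCert hSc hEc reps).exists_decide (rePred_unsafeCert (T := T) hSc)
  refine ⟨d, hd, fun n s l K 𝓟 _ hlim c hc => ?_⟩
  have hsafe : SafeCert S E reps (mkInput n K c) ↔
      (limitProgram T 𝓟).SafeFrom K {fun _ _ => false} :=
    ⟨SafeCert.safeFrom hS hc K hE hhom hreps (locCompat_limitProgram_self hlim),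
      safeCert_of_safeFrom hS hc K hE hhom hwqo reps⟩
  rw [safe_iff_limitProgram hlim K, ← hsafe]
  exact hdec _ (by rw [unsafeCert_iff hS hc K, hsafe])
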